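/- Let $A$ be a separable unital $C^*$-algebra (with $1\neq 0$), and let $\alpha\colon\mathbb{T}\to\operatorname{Aut}(A)$ be an action of the circle that is continuous for the topology of pointwise norm convergence. Suppose that $\alpha$ has the Rokhlin property: for every finite set $F\subseteq A$ and every $\varepsilon>0$ there is a unitary $u\in A$ with $\|\alpha_\zeta(u)-\zeta u\|<\varepsilon$ for all $\zeta\in\mathbb{T}$ and $\|ua-au\|<\varepsilon$ for all $a\in F$. For an integer $n\geq 1$ let $\alpha|_{\mathbb{Z}_n}$ be the restriction of $\alpha$ to $\mathbb{Z}_n$, identified with the group of $n$-th roots of unity in $\mathbb{T}$. Let $\mathcal{Q}=\varinjlim_n M_{n!}(\mathbb{C})$ be the universal UHF algebra, that is, the UHF algebra with $(K_0(\mathcal{Q}),[1])\cong(\mathbb{Q},1)$, and let $\mathcal{O}_2$ be the Cuntz algebra generated by two isometries $s_1,s_2$ with $s_1s_1^*+s_2s_2^*=1$. (1) If $A$ absorbs $\mathcal{Q}$ tensorially, i.e. $A\otimes\mathcal{Q}\cong A$, then for every $n\geq 1$ the action $\alpha|_{\mathbb{Z}_n}$ has the Rokhlin property: for every finite set $F\subseteq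 A$ and every $\varepsilon>0$ there are pairwise orthogonal projections $e_g\in A$, $g\in\mathbb{Z}_n$, such that $\|\alpha_g(e_h)-e_{gh}\|<\varepsilon$ for all $g,h\in\mathbb{Z}_n$, $\|e_ga-ae_g\|<\varepsilon$ for all $g\in\mathbb{Z}_n$ and $a\in F$, and $\sum_{g\in\mathbb{Z}_n}e_g=1$. (2) In particular, if $A$ absorbs $\mathcal{O}_2$ tensorially, i.e. $A\otimes\mathcal{O}_2\cong A$, then $\alpha|_{\mathbb{Z}_n}$ has the Rokhlin property for every $n\geq 1$. -/

import Mathlib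

open scoped TensorProduct

noncomputable section

/-! ### Concrete operators on `ℓ²(ℕ)` -/

/-- The Hilbert space `ℓ²(ℕ)`. -/
abbrev EllTwo : Type := lp (fun _ : ℕ => ℂ) 2

/-- The standard orthonormal basis `(e_k)` of `ℓ²(ℕ)`. -/
def stdBasis : HilbertBasis ℕ ℂ EllTwo := ⟨LinearIsometryEquiv.refl ℂ EllTwo⟩

theorem injective_mul_add {n : ℕ} (i : Fin n) : Function.Injective fun k : ℕ => n * k + i := by
  intro a b h
  have hn : 0 < n := lt_of_le_of_lt (Nat.zero_le _) i.isLt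
  exact Nat.eq_of_mul_eq_mul_left hn (Nat.add_right_cancel h)

theorem orthonormal_stdBasis_mul_add {n : ℕ} (i : Fin n) :
    Orthonormal ℂ fun k : ℕ => stdBasis (n * k + i) :=
  stdBasis.orthonormal.comp _ (injective_mul_add i)

/-- For `0 ≤ i < n`, the isometry `V_{n,i}` of `ℓ²(ℕ)` with `V_{n,i} e_k = e_{nk+i}`. -/
def blockIsometry (n : ℕ) (i : Fin n) : EllTwo →L[ℂ] EllTwo :=
  (orthonormal_stdBasis_mul_add i).orthogonalFamily.linearIsometry.toContinuousLinearMap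

theorem blockIsometry_apply_stdBasis (n : ℕ) (i : Fin n) (k : ℕ) :
    blockIsometry n i (stdBasis k) = stdBasis (n * k + i) := by
  have h := (orthonormal_stdBasis_mul_add i).orthogonalFamily.linearIsometry_apply_single
    (i := k) (1 : ℂ)
  have e : stdBasis k = lp.single 2 k (1 : ℂ) := (stdBasis.repr_symm_single k).symm
  rw [e]
  refine h.trans ?_
  simp

/-! ### The universal UHF algebra and the Cuntz algebra `𝒪₂` -/

/-- The universal UHF algebra `𝒬 = lim M_{n!}`, as a concrete C*-algebra: the norm closure of the
*-algebra of operators on `ℓ²(ℕ)` generated by all `V_{n,i} V_{n,j}^*`, `n ≥ 1`, `0 ≤ i, j < n`.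
For fixed `n` these operators are the matrix units `e_{nq+j} ↦ e_{nq+i}` (and `e_{nq+l} ↦ 0` for
`l ≠ j`, `0 ≤ l < n`) of a unital copy of `M_n`, and since
`V_{n,i} V_{n,j}^* = ∑_{r < m} V_{nm,nr+i} V_{nm,nr+j}^*`, the copy of `M_n` sits unitally in that of
`M_{nm}`; so this is the closure of the increasing union of the unital matrix algebras `M_{n!}`. -/
def universalUHF : StarSubalgebra ℂ (EllTwo →L[ℂ] EllTwo) :=
  (StarAlgebra.adjoin ℂ
    {T | ∃ (n : ℕ) (i j : Fin n), T = blockIsometry n i * star (blockIsometry n j)}).topologicalClosure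

instance : CStarAlgebra universalUHF :=
  StarSubalgebra.cstarAlgebra universalUHF
    (h_closed := StarSubalgebra.isClosed_topologicalClosure _)

/-- The Cuntz algebra `𝒪₂`, as the C*-algebra generated by the two isometries `s₁ e_k = e_{2k}` and
`s₂ e_k = e_{2k+1}` of `ℓ²(ℕ)`, which satisfy `s₁ s₁^* + s₂ s₂^* = 1`. (By Cuntz's uniqueness theorem
any two isometries with this relation generate the same C*-algebra up to isomorphism.) -/
def cuntzTwo : StarSubalgebra ℂ (EllTwo →L[ℂ] EllTwo) :=
  (StarAlgebra.adjoin ℂ {blockIsometry 2 0, blockIsometry 2 1}).topologicalClosure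

instance : CStarAlgebra cuntzTwo :=
  StarSubalgebra.cstarAlgebra cuntzTwo
    (h_closed := StarSubalgebra.isClosed_topologicalClosure _)

/-! ### C*-tensor products and absorption -/

/-- `C`, with the unital *-homomorphisms `i : A → C` and `j : D → C`, is a C*-tensor product of the
unital C*-algebras `A` and `D`: the ranges commute, and the induced map `a ⊗ d ↦ i a * j d` identifies
the algebraic tensor product with a dense *-subalgebra of `C`. In other words `C` is the completion of
`A ⊙ D` in a C*-norm. If `D` is nuclear there is exactly one such norm, so that
`C` is `A ⊗ D`. -/
structure IsCStarTensorProduct {A D C : Type*} [CStarAlgebra A] [CStarAlgebra D] [CStarAlgebra C]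
    (i : A →⋆ₐ[ℂ] C) (j : D →⋆ₐ[ℂ] C) : Prop where
  commute : ∀ a d, Commute (i a) (j d)
  injective : Function.Injective (Algebra.TensorProduct.lift i.toAlgHom j.toAlgHom commute)
  denseRange : DenseRange (Algebra.TensorProduct.lift i.toAlgHom j.toAlgHom commute)

/-- `A` absorbs the (nuclear) C*-algebra `D` tensorially: `A ⊗ D ≅ A`. -/
def TensoriallyAbsorbs.{u, v} (A : Type u) (D : Type v) [CStarAlgebra A] [CStarAlgebra D] : Prop :=
  ∃ (C : Type u) (_ : CStarAlgebra C) (i : A →⋆ₐ[ℂ] C) (j : D →⋆ₐ[ℂ] C),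
    IsCStarTensorProduct i j ∧ Nonempty (C ≃⋆ₐ[ℂ] A)

/-! ### The Rokhlin property -/

/-- The Rokhlin property for an action of a finite group `G` on a unital C*-algebra. -/
def FiniteRokhlinProperty {G A : Type*} [Group G] [Fintype G] [CStarAlgebra A]
    (α : G →* (A ≃⋆ₐ[ℂ] A)) : Prop :=
  ∀ (F : Finset A) (ε : ℝ), 0 < ε → ∃ e : G → A,
    (∀ g, IsStarProjection (e g)) ∧
    (∀ g h, g ≠ h → e g * e h = 0) ∧
    (∀ g h, ‖α g (e h) - e (g * h)‖ < ε) ∧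
    (∀ g, ∀ a ∈ F, ‖e g * a - a * e g‖ < ε) ∧
    ∑ g, e g = 1

/-- The Rokhlin property for an action of the circle on a unital C*-algebra. -/
def CircleRokhlinProperty {A : Type*} [CStarAlgebra A] (α : Circle →* (A ≃⋆ₐ[ℂ] A)) : Prop :=
  ∀ (F : Finset A) (ε : ℝ), 0 < ε → ∃ u ∈ unitary A,
    (∀ ζ : Circle, ‖α ζ u - (ζ : ℂ) • u‖ < ε) ∧
    (∀ a ∈ F, ‖u * a - a * u‖ < ε)

/-- The restriction of a circle action to `ℤ_n`, embedded in the circle as the `n`-th roots of unity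
by `j ↦ exp(2πij/n)`. -/
def restrictCyclic {A : Type*} [CStarAlgebra A] (α : Circle →* (A ≃⋆ₐ[ℂ] A)) (n : ℕ) [NeZero n] :
    Multiplicative (ZMod n) →* (A ≃⋆ₐ[ℂ] A) :=
  α.comp (ZMod.toCircle (N := n)).toMonoidHom

end

/-! ### Norm estimates in C*-algebras -/

section NormEstimates

variable {A : Type*} [CStarAlgebra A]

/-! Absorption of `𝒬` or `𝒪₂` enters only through `HasCentralMatrixUnits`: every finite subset of
`A` almost commutes with some unital copy `φ(M_n)`. Let `P_ζ` be the projection of `M_n` onto the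
line of `(1, ζ, …, ζ^{n-1})`. For fixed `ζ` the `P_{ζ g⁻¹}`, `g ∈ ℤ_n`, are orthogonal with sum one,
so the functions `E_g(ζ) = α_ζ(φ(P_{ζ g⁻¹}))` on the circle form a continuous partition of unity
into projections, and `α_g(E_h(ζ)) = E_{gh}(gζ)` holds exactly.

A Rokhlin unitary `u` almost commutes with finite sets and satisfies `α_ζ(u) ≈ ζu`, so evaluating
such functions along `u` lands in `A` and turns translation of the variable into the action. The
evaluation is `compress`, namely `X ↦ ∑ b_r^* X_r b_r` over the `N`-th roots of unity `ζ_r`, where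
`b_r` is the mean of the first `N` powers of `ζ_r u`. One has `∑ b_r^* b_r = 1`, and the second
moment `∑ b_r^* |ζ_r u - 1|² b_r = N⁻¹ |u^N - 1|²` has norm at most `4/N`. This makes the evaluation
almost multiplicative on continuous functions (`norm_compress_mul_sub_le`), and
`exists_projections_near` corrects the resulting almost projections.

Central matrix units pass from `D` to any `A` absorbing `D`. In `𝒬` they are exact: `x ↦ ∑ V_{N,i} x
V_{N,i}^*` maps into the commutant of the copy of `M_m` whenever `m ∣ N`. In `𝒪₂` put `λ(x) = ∑ s_i
x s_i^*`. Since `λ(x) s_i = s_i x`, elements almost fixed by `λ` almost commute with the generators.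
If `t` is a Cuntz family of `n` words and `W = ∑ λ(t_k) t_k^*`, then `λ(t_i t_j^*) = W t_i t_j^*
W^*`, so it suffices to find a unitary `v` with `λ(v) W ≈ v`; conjugating by `v` then gives almost
fixed matrix units.

Such a `v` comes from a Rokhlin tower argument. Anticommuting unitaries of Jordan–Wigner type yield
a projection almost flipped by a power of `λ` (`exists_flipped_projection`), and repeated doubling
gives towers of height `m = 2^k` (`exists_tower`). The cocycle `W_m` lies in a finite-dimensional
algebra, hence is joined to `1` by `m` short steps; spreading these steps over the tower solves the
coboundary equation approximately. -/

theorem norm_le_of_neg_le_of_le [PartialOrder A] [StarOrderedRing A] {a b : A}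
    (ha : IsSelfAdjoint a) (h₁ : -b ≤ a) (h₂ : a ≤ b) (hb : IsSelfAdjoint b) : ‖a‖ ≤ ‖b‖ := by
  nontriviality A
  have h₃ : a ≤ algebraMap ℝ A ‖b‖ := h₂.trans hb.le_algebraMap_norm_self
  have h₄ : -a ≤ algebraMap ℝ A ‖b‖ := (neg_le.mp h₁).trans hb.le_algebraMap_norm_self
  rw [le_algebraMap_iff_spectrum_le] at h₃ h₄
  rcases CStarAlgebra.norm_or_neg_norm_mem_spectrum (a := a) ha with h | h
  · exact h₃ _ h
  · refine h₄ _ ?_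
    rw [← spectrum.neg_eq]
    simpa using h

/-- Each `c^* X c` lies between `±‖X‖ c^* c`, and order inequalities can be summed. The gain over
the triangle inequality is that the number of terms does not appear. -/
theorem norm_sum_conj_le_of_isSelfAdjoint {ι : Type*} [Fintype ι] (c X : ι → A) (t : ι → ℝ)
    (hX : ∀ i, IsSelfAdjoint (X i)) (ht : ∀ i, ‖X i‖ ≤ t i) :
    ‖∑ i, star (c i) * X i * c i‖ ≤ ‖∑ i, (t i : ℂ) • (star (c i) * c i)‖ := by
  let _ := CStarAlgebra.spectralOrder A
  let _ := CStarAlgebra.spectralOrderedRing A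
  have key : ∀ Y : A, IsSelfAdjoint Y → ∀ (s : ℝ) (d : A), ‖Y‖ ≤ s →
      star d * Y * d ≤ (s : ℂ) • (star d * d) := by
    intro Y hY s d hs
    refine (CStarAlgebra.star_left_conjugate_le_norm_smul (a := d) (b := Y) hY).trans ?_
    rw [Complex.coe_smul]
    exact smul_le_smul_of_nonneg_right hs (star_mul_self_nonneg d)
  refine norm_le_of_neg_le_of_le ?_ ?_ ?_ ?_
  · exact isSelfAdjoint_sum _ fun i _ => (hX i).conjugate' _
  · rw [← Finset.sum_neg_distrib]
    refine Finset.sum_le_sum fun i _ => ?_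
    have := key (-X i) (hX i).neg (t i) (c i) (by simpa using ht i)
    rw [neg_le]
    simpa [mul_neg, neg_mul] using this
  · exact Finset.sum_le_sum fun i _ => key _ (hX i) _ _ (ht i)
  · refine isSelfAdjoint_sum _ fun i _ => ?_
    exact IsSelfAdjoint.smul (Complex.conj_ofReal _) (IsSelfAdjoint.star_mul_self _)

/-- The factor 2 is the price of treating real and imaginary parts separately. -/
theorem norm_sum_conj_le {ι : Type*} [Fintype ι] (c X : ι → A) (t : ι → ℝ)
    (ht : ∀ i, ‖X i‖ ≤ t i) :
    ‖∑ i, star (c i) * X i * c i‖ ≤ 2 * ‖∑ i, (t i : ℂ) • (star (c i) * c i)‖ := by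
  have h1 := norm_sum_conj_le_of_isSelfAdjoint c (fun i => (realPart (X i) : A)) t
    (fun i => (realPart (X i)).2) (fun i => (realPart.norm_le (X i)).trans (ht i))
  have h2 := norm_sum_conj_le_of_isSelfAdjoint c (fun i => (imaginaryPart (X i) : A)) t
    (fun i => (imaginaryPart (X i)).2) (fun i => (imaginaryPart.norm_le (X i)).trans (ht i))
  have h3 : ∑ i, star (c i) * X i * c i = (∑ i, star (c i) * (realPart (X i) : A) * c i) +
      Complex.I • ∑ i, star (c i) * (imaginaryPart (X i) : A) * c i := by
    rw [Finset.smul_sum, ← Finset.sum_add_distrib]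
    refine Finset.sum_congr rfl fun i _ => ?_
    conv_lhs => rw [← realPart_add_I_smul_imaginaryPart (X i)]
    simp [mul_add, add_mul]
  rw [h3]
  refine (norm_add_le _ _).trans ?_
  rw [norm_smul, Complex.norm_I]
  linarith

/-- If `∑ c_i^* c_i = 1`, compressing by the column `c` is bounded by twice the largest norm. -/
theorem norm_sum_conj_le_of_sum_eq_one [Nontrivial A] {ι : Type*} [Fintype ι] (c X : ι → A)
    (hc : ∑ i, star (c i) * c i = 1) {t : ℝ} (ht : ∀ i, ‖X i‖ ≤ t) (ht0 : 0 ≤ t) :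
    ‖∑ i, star (c i) * X i * c i‖ ≤ 2 * t := by
  refine (norm_sum_conj_le c X (fun _ => t) ht).trans ?_
  rw [← Finset.smul_sum, hc, norm_smul, Complex.norm_real, Real.norm_of_nonneg ht0]
  simp

end NormEstimates

/-! ### Approximate partitions of unity into projections -/

section Perturbation

variable {A : Type*} [CStarAlgebra A] {ι : Type*} [Fintype ι] [DecidableEq ι]

open Polynomial in
/-- A polynomial in `∑ x_k p_k` is close to `∑ q(x_k) p_k` if the `p_k` are almost orthogonal
projections. -/
theorem exists_norm_aeval_sub_le (x : ι → ℝ) (q : ℝ[X]) :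
    ∃ C : ℝ, 0 ≤ C ∧ ∀ (p : ι → A) (δ : ℝ), ∑ k, p k = 1 → (∀ k, ‖p k‖ ≤ 2) →
      (∀ k l, ‖p k * p l - if k = l then p k else 0‖ ≤ δ) →
      ‖aeval (∑ k, x k • p k) q - ∑ k, q.eval (x k) • p k‖ ≤ C * δ := by
  induction q using Polynomial.induction_on with
  | C a =>
    refine ⟨0, le_rfl, fun p δ hp _ _ => ?_⟩
    simp [← Finset.smul_sum, hp, Algebra.algebraMap_eq_smul_one]
  | add q r hq hr =>
    obtain ⟨C, hC, h⟩ := hq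
    obtain ⟨C', hC', h'⟩ := hr
    refine ⟨C + C', by positivity, fun p δ hp hn ho => ?_⟩
    have e : aeval (∑ k, x k • p k) (q + r) - ∑ k, (q + r).eval (x k) • p k =
        (aeval (∑ k, x k • p k) q - ∑ k, q.eval (x k) • p k) +
        (aeval (∑ k, x k • p k) r - ∑ k, r.eval (x k) • p k) := by
      simp only [map_add, eval_add, add_smul, Finset.sum_add_distrib]
      abel
    rw [e, add_mul]
    exact (norm_add_le _ _).trans (add_le_add (h p δ hp hn ho) (h' p δ hp hn ho))
  | monomial n a hq =>
    obtain ⟨C', hC', h⟩ := hq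
    set q : ℝ[X] := Polynomial.C a * X ^ n
    -- The first summand bounds `∑ x_k p_k` times the inductive error, the second collects the
    -- defects of the products `p_k p_l`.
    refine ⟨(∑ k, |x k| * 2) * C' + ∑ k, ∑ l, |x k| * |q.eval (x l)|, by positivity,
      fun p δ hp hn ho => ?_⟩
    have hδ : ∀ k l : ι, 0 ≤ δ := fun k l => (norm_nonneg _).trans (ho k l)
    have e : aeval (∑ k, x k • p k) (Polynomial.C a * X ^ (n + 1)) -
        ∑ k, (Polynomial.C a * X ^ (n + 1)).eval (x k) • p k =
        (∑ k, x k • p k) * (aeval (∑ k, x k • p k) q - ∑ k, q.eval (x k) • p k) +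
        ∑ k, ∑ l, (x k * q.eval (x l)) • (p k * p l - if k = l then p k else 0) := by
      have e1 : Polynomial.C a * X ^ (n + 1) = X * q := by simp only [q]; ring
      rw [e1]
      simp only [map_mul, aeval_X, mul_sub, Finset.sum_mul_sum, smul_sub, Finset.sum_sub_distrib,
        eval_mul, eval_X, smul_mul_smul_comm]
      simp [smul_ite]
    rw [e, add_mul]
    refine (norm_add_le _ _).trans (add_le_add ?_ ?_)
    · rw [mul_assoc]
      refine (norm_mul_le _ _).trans (mul_le_mul ?_ (h p δ hp hn ho) (norm_nonneg _)
        (by positivity))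
      refine norm_sum_le_of_le _ fun k _ => ?_
      rw [norm_smul, Real.norm_eq_abs]
      exact mul_le_mul_of_nonneg_left (hn k) (abs_nonneg _)
    · rw [Finset.sum_mul]
      refine norm_sum_le_of_le _ fun k _ => ?_
      rw [Finset.sum_mul]
      refine norm_sum_le_of_le _ fun l _ => ?_
      rw [norm_smul, Real.norm_eq_abs, abs_mul]
      exact mul_le_mul_of_nonneg_left (ho k l) (by positivity)

/-- A continuous bump function of height one at `c`. -/
noncomputable def bump (c x : ℝ) : ℝ := max 0 (min 1 (2 - 3 * |x - c|))

theorem continuous_bump (c : ℝ) : Continuous (bump c) := by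
  unfold bump; fun_prop

theorem bump_eq_one {c x : ℝ} (h : |x - c| ≤ 1 / 3) : bump c x = 1 := by
  unfold bump
  rw [min_eq_left (by linarith), max_eq_right zero_le_one]

theorem bump_eq_zero {c x : ℝ} (h : 2 / 3 ≤ |x - c|) : bump c x = 0 := by
  unfold bump
  rw [max_eq_left]
  exact (min_le_right _ _).trans (by linarith)

/-- Almost orthogonal almost projections with sum one are close to orthogonal projections with sum
one. -/
theorem exists_projections_near [Nontrivial A] {ε : ℝ} (hε : 0 < ε) :
    ∃ δ : ℝ, 0 < δ ∧ ∀ p : ι → A, (∀ k, IsSelfAdjoint (p k)) → ∑ k, p k = 1 →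
      (∀ k, ‖p k‖ ≤ 2) → (∀ k l, ‖p k * p l - if k = l then p k else 0‖ ≤ δ) →
      ∃ e : ι → A, (∀ k, IsStarProjection (e k)) ∧ (∀ k l, k ≠ l → e k * e l = 0) ∧
        ∑ k, e k = 1 ∧ ∀ k, ‖e k - p k‖ < ε := by
  -- Distinct integers serve as eigenvalue labels: `h = ∑ x_k p_k` should have spectrum near them,
  -- and its spectral projections are the required `e_k`. The Lagrange polynomials recover `p_k`
  -- from `h` up to a small error.
  set x : ι → ℝ := fun k => (Fintype.equivFin ι k : ℕ) with hx
  have hsep : ∀ k l, k ≠ l → 1 ≤ |x k - x l| := by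
    intro k l hkl
    have h1 : ((Fintype.equivFin ι k : ℕ) : ℤ) - (Fintype.equivFin ι l : ℕ) ≠ 0 := by
      rw [sub_ne_zero]
      intro h
      exact hkl ((Fintype.equivFin ι).injective (Fin.ext (by exact_mod_cast h)))
    have h2 := Int.one_le_abs h1
    have h3 : ((1 : ℤ) : ℝ) ≤ ((|((Fintype.equivFin ι k : ℕ) : ℤ) - (Fintype.equivFin ι l : ℕ)| : ℤ) : ℝ) :=
      Int.cast_le.mpr h2
    simpa [hx] using h3
  have hinj : Set.InjOn x (Finset.univ : Finset ι) := by
    intro k _ l _ h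
    by_contra hkl
    have := hsep k l hkl
    rw [h, sub_self, abs_zero] at this
    linarith
  set Lg : ι → Polynomial ℝ := fun k => Lagrange.basis Finset.univ x k with hLg
  have hLgev : ∀ k l, (Lg k).eval (x l) = if k = l then 1 else 0 := by
    intro k l
    split_ifs with h
    · subst h; exact Lagrange.eval_basis_self hinj (Finset.mem_univ k)
    · exact Lagrange.eval_basis_of_ne h (Finset.mem_univ l)
  -- `Q` vanishes at every label, so `Q(h)` is small; a spectral point at distance more than `η₀`
  -- from all labels would make its norm at least `η₀ ^ n`.
  set Q : Polynomial ℝ := Lagrange.nodal Finset.univ x with hQ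
  have hcont : ∀ k l, ∃ η > 0, ∀ y, |y - x l| ≤ η → |(Lg k).eval y - (Lg k).eval (x l)| ≤ ε / 4 := by
    intro k l
    obtain ⟨η, hη, h⟩ := Metric.continuous_iff.mp (Lg k).continuous (x l) (ε / 4) (by positivity)
    refine ⟨η / 2, by positivity, fun y hy => ?_⟩
    have := h y (by rw [Real.dist_eq]; linarith)
    rw [Real.dist_eq] at this
    exact this.le
  choose η hη hηc using hcont
  obtain ⟨η₀, hη₀, hη₀'⟩ : ∃ η₀ > 0, ∀ k l, η₀ ≤ η k l ∧ η₀ ≤ 1 / 3 := by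
    rcases isEmpty_or_nonempty ι with h | h
    · exact ⟨1, one_pos, fun k => h.elim k⟩
    · refine ⟨min (1 / 3) (Finset.univ.inf' Finset.univ_nonempty fun kl : ι × ι => η kl.1 kl.2),
        lt_min (by norm_num) ((Finset.lt_inf'_iff _).mpr fun kl _ => hη _ _), fun k l =>
        ⟨(min_le_right _ _).trans ?_, min_le_left _ _⟩⟩
      exact Finset.inf'_le (fun kl : ι × ι => η kl.1 kl.2) (Finset.mem_univ (k, l))
  obtain ⟨C, hC, hCQ⟩ := exists_norm_aeval_sub_le (A := A) x Q
  choose CL hCL hCLL using fun k => exists_norm_aeval_sub_le (A := A) x (Lg k)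
  set C' : ℝ := C + ∑ k, CL k + 1
  have hC' : 0 < C' := by
    have : 0 ≤ ∑ k, CL k := Finset.sum_nonneg fun k _ => hCL k
    positivity
  set n := Fintype.card ι
  -- `η₀ ^ n / 2` serves the localisation of the spectrum, `ε / 4` the distance from `L_k(h)` to
  -- `p_k`.
  set δ : ℝ := min (ε / 4) (η₀ ^ n / 2) / C'
  have hδ : 0 < δ := by positivity
  have hCδ : C' * δ = min (ε / 4) (η₀ ^ n / 2) := by
    simp only [δ]; field_simp
  refine ⟨δ, hδ, fun p hsa hsum hn ho => ?_⟩
  set h : A := ∑ k, x k • p k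
  have hh : IsSelfAdjoint h := isSelfAdjoint_sum _ fun k _ => IsSelfAdjoint.smul (IsSelfAdjoint.all (x k)) (hsa k)
  have hspec : ∀ y ∈ spectrum ℝ h, ∃ l, |y - x l| ≤ η₀ := by
    intro y hy
    by_contra! hc
    have h1 : Q.eval y ∈ spectrum ℝ (Polynomial.aeval h Q) :=
      spectrum.subset_polynomial_aeval h Q ⟨y, hy, rfl⟩
    have h2 := spectrum.norm_le_norm_of_mem h1
    have h3 := hCQ p δ hsum hn ho
    have h4 : ∑ k, Q.eval (x k) • p k = 0 := by
      refine Finset.sum_eq_zero fun k _ => ?_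
      rw [hQ, Lagrange.eval_nodal_at_node (Finset.mem_univ k), zero_smul]
    rw [h4, sub_zero] at h3
    have h5 : η₀ ^ n ≤ ‖Q.eval y‖ := by
      rw [hQ, Lagrange.eval_nodal, norm_prod]
      calc η₀ ^ n = ∏ _k : ι, η₀ := by simp [n]
        _ ≤ _ := Finset.prod_le_prod (fun _ _ => hη₀.le) fun k _ => (hc k).le
    have h6 : C * δ ≤ C' * δ := by
      refine mul_le_mul_of_nonneg_right ?_ hδ.le
      have : 0 ≤ ∑ k, CL k := Finset.sum_nonneg fun k _ => hCL k
      simp only [C']; linarith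
    have h7 : C' * δ ≤ η₀ ^ n / 2 := hCδ ▸ min_le_right _ _
    have : 0 < η₀ ^ n := by positivity
    change ‖(Polynomial.aeval h) Q‖ ≤ C * δ at h3
    linarith
  -- Labels are at least 1 apart and `η₀ ≤ 1/3`, so on the spectrum each bump takes only the values
  -- 0 and 1.
  have hbump : ∀ y ∈ spectrum ℝ h, ∃ l, |y - x l| ≤ η₀ ∧
      ∀ k, bump (x k) y = if k = l then 1 else 0 := by
    intro y hy
    obtain ⟨l, hl⟩ := hspec y hy
    refine ⟨l, hl, fun k => ?_⟩
    have h3 := (hη₀' l l).2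
    split_ifs with hkl
    · subst hkl; exact bump_eq_one (hl.trans h3)
    · refine bump_eq_zero ?_
      have h1 := hsep l k (Ne.symm hkl)
      have h2 := abs_sub_le (x l) y (x k)
      rw [abs_sub_comm (x l) y] at h2
      linarith
  refine ⟨fun k => cfc (bump (x k)) h, fun k => ⟨?_, cfc_predicate _ _⟩, fun k l hkl => ?_, ?_,
    fun k => ?_⟩
  · change cfc (bump (x k)) h * cfc (bump (x k)) h = cfc (bump (x k)) h
    rw [← cfc_mul _ _ _ (continuous_bump _).continuousOn (continuous_bump _).continuousOn]
    refine cfc_congr fun y hy => ?_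
    obtain ⟨l, -, hl⟩ := hbump y hy
    simp [hl]
  · rw [← cfc_mul _ _ _ (continuous_bump _).continuousOn (continuous_bump _).continuousOn,
      ← cfc_const_zero ℝ h]
    refine cfc_congr fun y hy => ?_
    obtain ⟨l', -, hl'⟩ := hbump y hy
    simp only [hl']
    split_ifs with h1 h2
    · exact absurd (h1.trans h2.symm) hkl
    all_goals simp
  · rw [← cfc_sum _ _ _ (fun k _ => (continuous_bump _).continuousOn), ← cfc_const_one ℝ h]
    refine cfc_congr fun y hy => ?_
    obtain ⟨l', -, hl'⟩ := hbump y hy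
    simp [hl']
  · have h1 := hCLL k p δ hsum hn ho
    have h2 : ∑ l, (Lg k).eval (x l) • p l = p k := by simp [hLgev]
    rw [h2] at h1
    have h3 : ‖cfc (bump (x k)) h - cfc (Lg k).eval h‖ ≤ ε / 4 := by
      rw [← cfc_sub _ _ _ (continuous_bump _).continuousOn (Lg k).continuous.continuousOn]
      refine norm_cfc_le (by positivity) fun y hy => ?_
      obtain ⟨l, hl, hl'⟩ := hbump y hy
      have h4 := hηc k l y (hl.trans (hη₀' k l).1)
      rw [hLgev, abs_sub_comm] at h4
      simpa only [hl', Real.norm_eq_abs] using h4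
    rw [cfc_polynomial (Lg k) h hh] at h3
    have h6 : CL k * δ ≤ C' * δ := by
      refine mul_le_mul_of_nonneg_right ?_ hδ.le
      have := Finset.single_le_sum (fun k _ => hCL k) (Finset.mem_univ k)
      simp only [C']; linarith
    have h7 : C' * δ ≤ ε / 4 := hCδ ▸ min_le_left _ _
    calc _ = ‖(cfc (bump (x k)) h - Polynomial.aeval h (Lg k)) + (Polynomial.aeval h (Lg k) - p k)‖ := by
          congr 1; abel
      _ ≤ ε / 4 + C' * δ := (norm_add_le _ _).trans (add_le_add h3 (h1.trans h6))
      _ < ε := by linarith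

end Perturbation

/-! ### Cesàro means of powers -/

section Cesaro

variable {A : Type*} [CStarAlgebra A]

theorem norm_pow_le_one_of_norm_le_one [Nontrivial A] {x : A} (hx : ‖x‖ ≤ 1) (j : ℕ) :
    ‖x ^ j‖ ≤ 1 :=
  (norm_pow_le x j).trans (pow_le_one₀ (norm_nonneg _) hx)

theorem norm_pow_sub_pow_le [Nontrivial A] {x y : A} (hx : ‖x‖ ≤ 1) (hy : ‖y‖ ≤ 1) (j : ℕ) :
    ‖x ^ j - y ^ j‖ ≤ j * ‖x - y‖ := by
  induction j with
  | zero => simp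
  | succ j ih =>
    have e : x ^ (j + 1) - y ^ (j + 1) = x ^ j * (x - y) + (x ^ j - y ^ j) * y := by
      simp only [pow_succ, mul_sub, sub_mul]; abel
    rw [e]
    have h1 : ‖x ^ j * (x - y)‖ ≤ 1 * ‖x - y‖ := (norm_mul_le _ _).trans
      (mul_le_mul_of_nonneg_right (norm_pow_le_one_of_norm_le_one hx j) (norm_nonneg _))
    have h2 : ‖(x ^ j - y ^ j) * y‖ ≤ (j * ‖x - y‖) * 1 :=
      (norm_mul_le _ _).trans (mul_le_mul ih hy (norm_nonneg _) (by positivity))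
    refine (norm_add_le _ _).trans ?_
    push_cast
    linarith

theorem norm_pow_mul_sub_mul_pow_le [Nontrivial A] {x : A} (hx : ‖x‖ ≤ 1) (a : A) (j : ℕ) :
    ‖x ^ j * a - a * x ^ j‖ ≤ j * ‖x * a - a * x‖ := by
  induction j with
  | zero => simp
  | succ j ih =>
    have e : x ^ (j + 1) * a - a * x ^ (j + 1) =
        x ^ j * (x * a - a * x) + (x ^ j * a - a * x ^ j) * x := by
      simp only [pow_succ, mul_sub, sub_mul, mul_assoc]; abel
    rw [e]
    have h1 : ‖x ^ j * (x * a - a * x)‖ ≤ 1 * ‖x * a - a * x‖ := (norm_mul_le _ _).trans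
      (mul_le_mul_of_nonneg_right (norm_pow_le_one_of_norm_le_one hx j) (norm_nonneg _))
    have h2 : ‖(x ^ j * a - a * x ^ j) * x‖ ≤ (j * ‖x * a - a * x‖) * 1 :=
      (norm_mul_le _ _).trans (mul_le_mul ih hx (norm_nonneg _) (by positivity))
    refine (norm_add_le _ _).trans ?_
    push_cast
    linarith

/-- The mean `(1/N) ∑_{j<N} x^j`. -/
noncomputable def cesaro (N : ℕ) (x : A) : A := (N : ℂ)⁻¹ • ∑ j ∈ Finset.range N, x ^ j

theorem norm_inv_smul_sum_range_le (N : ℕ) (f : ℕ → A) {c : ℝ} (hc : 0 ≤ c)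
    (h : ∀ j < N, ‖f j‖ ≤ c) : ‖(N : ℂ)⁻¹ • ∑ j ∈ Finset.range N, f j‖ ≤ c := by
  rcases Nat.eq_zero_or_pos N with rfl | hN
  · simpa using hc
  have h1 : ‖∑ j ∈ Finset.range N, f j‖ ≤ N * c := by
    refine (norm_sum_le_of_le _ (fun j hj => h j (Finset.mem_range.mp hj))).trans ?_
    simp
  rw [norm_smul, norm_inv, Complex.norm_natCast]
  have : (0 : ℝ) < N := by exact_mod_cast hN
  rwa [inv_mul_le_iff₀ this]

theorem norm_cesaro_le [Nontrivial A] (N : ℕ) {x : A} (hx : ‖x‖ ≤ 1) : ‖cesaro N x‖ ≤ 1 :=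
  norm_inv_smul_sum_range_le N _ zero_le_one fun j _ => norm_pow_le_one_of_norm_le_one hx j

theorem norm_cesaro_sub_le [Nontrivial A] (N : ℕ) {x y : A} (hx : ‖x‖ ≤ 1) (hy : ‖y‖ ≤ 1) :
    ‖cesaro N x - cesaro N y‖ ≤ N * ‖x - y‖ := by
  rw [cesaro, cesaro, ← smul_sub, ← Finset.sum_sub_distrib]
  refine norm_inv_smul_sum_range_le N _ (by positivity) fun j hj =>
    (norm_pow_sub_pow_le hx hy j).trans ?_
  gcongr

theorem norm_cesaro_mul_sub_le [Nontrivial A] (N : ℕ) {x : A} (hx : ‖x‖ ≤ 1) (a : A) :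
    ‖cesaro N x * a - a * cesaro N x‖ ≤ N * ‖x * a - a * x‖ := by
  rw [cesaro, smul_mul_assoc, mul_smul_comm, ← smul_sub, Finset.sum_mul, Finset.mul_sum,
    ← Finset.sum_sub_distrib]
  refine norm_inv_smul_sum_range_le N _ (by positivity) fun j hj =>
    (norm_pow_mul_sub_mul_pow_le hx a j).trans ?_
  gcongr

/-- The geometric sum telescopes. For unitary `x` the right side is `O(1/N)`, so the mean is
concentrated where `x` is near 1. -/
theorem sub_one_mul_cesaro (N : ℕ) (x : A) :
    (x - 1) * cesaro N x = (N : ℂ)⁻¹ • (x ^ N - 1) := by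
  rw [cesaro, mul_smul_comm, mul_geom_sum]

theorem Commute.cesaro_right {x y : A} (h : Commute x y) (N : ℕ) : Commute x (cesaro N y) :=
  (Commute.sum_right _ _ _ fun j _ => h.pow_right j).smul_right _

theorem map_cesaro (N : ℕ) (β : A →⋆ₐ[ℂ] A) (x : A) : β (cesaro N x) = cesaro N (β x) := by
  simp [cesaro]

end Cesaro

/-! ### Roots of unity -/

section Roots

variable {N : ℕ} [NeZero N]

theorem toCircle_pow_card (r : ZMod N) : (ZMod.toCircle r : ℂ) ^ N = 1 := by
  have h : ZMod.toCircle r ^ N = 1 := by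
    rw [← AddChar.map_nsmul_eq_pow]
    simp
  exact_mod_cast congrArg (fun z : Circle => (z : ℂ)) h

theorem sum_range_toCircle_pow (r : ZMod N) :
    ∑ l ∈ Finset.range N, (ZMod.toCircle r : ℂ) ^ l = if r = 0 then (N : ℂ) else 0 := by
  split_ifs with h
  · simp [h]
  · have h1 : (ZMod.toCircle r : ℂ) - 1 ≠ 0 := by
      rw [sub_ne_zero]
      intro h2
      apply h
      apply ZMod.injective_toCircle
      rw [AddChar.map_zero_eq_one]
      exact Circle.ext h2
    have h2 := mul_geom_sum (ZMod.toCircle r : ℂ) N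
    rw [toCircle_pow_card, sub_self] at h2
    exact (mul_eq_zero.mp h2).resolve_left h1

theorem sum_range_toCircle_pow_mul_star_pow (r s : ZMod N) :
    ∑ l ∈ Finset.range N, (ZMod.toCircle r : ℂ) ^ l * star (ZMod.toCircle s : ℂ) ^ l =
      if r = s then (N : ℂ) else 0 := by
  have h : ∀ l, (ZMod.toCircle r : ℂ) ^ l * star (ZMod.toCircle s : ℂ) ^ l =
      (ZMod.toCircle (r - s) : ℂ) ^ l := by
    intro l
    rw [← mul_pow, AddChar.map_sub_eq_div, Circle.coe_div, div_eq_mul_inv, ← Circle.coe_inv,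
      Circle.coe_inv_eq_conj]
    rfl
  simp only [h, sum_range_toCircle_pow, sub_eq_zero]

/-- Orthogonality of characters; the bounds on `i` and `j` exclude exponents that agree only modulo
`N`. -/
theorem sum_star_toCircle_pow_mul_pow {i j : ℕ} (hi : i < N) (hj : j < N) :
    ∑ r : ZMod N, star (ZMod.toCircle r : ℂ) ^ i * (ZMod.toCircle r : ℂ) ^ j =
      if i = j then (N : ℂ) else 0 := by
  have h : ∀ r : ZMod N, star (ZMod.toCircle r : ℂ) ^ i * (ZMod.toCircle r : ℂ) ^ j =
      ZMod.stdAddChar (r * ((j : ZMod N) - (i : ZMod N))) := by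
    intro r
    have e : r * ((j : ZMod N) - (i : ZMod N)) = j • r - i • r := by simp [mul_sub, mul_comm]
    rw [e, AddChar.map_sub_eq_div, AddChar.map_nsmul_eq_pow, AddChar.map_nsmul_eq_pow,
      ZMod.stdAddChar_apply, div_eq_mul_inv, ← inv_pow, ← Circle.coe_inv,
      Circle.coe_inv_eq_conj, mul_comm]
    rfl
  simp only [h, AddChar.sum_mulShift _ (ZMod.isPrimitive_stdAddChar N), ZMod.card, sub_eq_zero]
  have : ((j : ZMod N) = i) ↔ i = j := by
    rw [ZMod.natCast_eq_natCast_iff', Nat.mod_eq_of_lt hi, Nat.mod_eq_of_lt hj, eq_comm]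
  simp [this]

end Roots

/-! ### The partition of unity attached to a unitary -/

section FourierColumn

variable {A : Type*} [CStarAlgebra A] (N : ℕ) [NeZero N]

/-- The mean of the powers of `ζ_r u`, where `ζ_r` runs over the `N`-th roots of unity. The elements
`b_r^* b_r` form a partition of unity which is concentrated at `u = ζ_r⁻¹`. -/
noncomputable def fourierColumn (u : A) (r : ZMod N) : A := cesaro N ((ZMod.toCircle r : ℂ) • u)

variable {N} {u : A}

theorem norm_toCircle_smul_le [Nontrivial A] (hu : u ∈ unitary A) (ζ : Circle) :
    ‖(ζ : ℂ) • u‖ ≤ 1 := by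
  rw [norm_smul, Circle.norm_coe, CStarRing.norm_of_mem_unitary hu, one_mul]

theorem norm_fourierColumn_le [Nontrivial A] (hu : u ∈ unitary A) (r : ZMod N) :
    ‖fourierColumn N u r‖ ≤ 1 :=
  norm_cesaro_le N (norm_toCircle_smul_le hu _)

/-- Expand both means: summing over `r` kills the terms with unequal exponents, and each of the `N`
diagonal terms contributes `N · 1`, cancelling the factor `N⁻²`. -/
theorem sum_star_fourierColumn_mul (hu : u ∈ unitary A) :
    ∑ r, star (fourierColumn N u r) * fourierColumn N u r = 1 := by
  have hN : (N : ℂ) ≠ 0 := NeZero.ne _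
  have h1 : ∀ r : ZMod N, star (fourierColumn N u r) * fourierColumn N u r =
      ((N : ℂ)⁻¹ * (N : ℂ)⁻¹) • ∑ i ∈ Finset.range N, ∑ j ∈ Finset.range N,
        (star (ZMod.toCircle r : ℂ) ^ i * (ZMod.toCircle r : ℂ) ^ j) • (star u ^ i * u ^ j) := by
    intro r
    simp only [fourierColumn, cesaro, star_smul, star_sum, star_pow, smul_mul_smul_comm,
      Finset.sum_mul_sum, smul_pow, star_inv₀, star_natCast]
  simp only [h1]
  rw [← Finset.smul_sum, Finset.sum_comm]
  have h2 : ∀ i ∈ Finset.range N, ∑ r : ZMod N, ∑ j ∈ Finset.range N,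
      (star (ZMod.toCircle r : ℂ) ^ i * (ZMod.toCircle r : ℂ) ^ j) • (star u ^ i * u ^ j) =
      (N : ℂ) • 1 := by
    intro i hi
    rw [Finset.sum_comm]
    have h3 : ∀ j ∈ Finset.range N, ∑ r : ZMod N,
        (star (ZMod.toCircle r : ℂ) ^ i * (ZMod.toCircle r : ℂ) ^ j) • (star u ^ i * u ^ j) =
        if i = j then (N : ℂ) • 1 else 0 := by
      intro j hj
      rw [← Finset.sum_smul, sum_star_toCircle_pow_mul_pow (Finset.mem_range.mp hi)
        (Finset.mem_range.mp hj)]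
      split_ifs with h
      · subst h
        rw [← star_pow, Unitary.star_mul_self_of_mem (pow_mem hu i)]
      · rw [zero_smul]
    rw [Finset.sum_congr rfl h3]
    simp [Finset.mem_range.mp hi]
  rw [Finset.sum_congr rfl h2, Finset.sum_const, Finset.card_range, ← Nat.cast_smul_eq_nsmul ℂ,
    smul_smul, smul_smul]
  field_simp
  simp

theorem commute_fourierColumn (u : A) (r s : ZMod N) :
    Commute (fourierColumn N u r) (fourierColumn N u s) :=
  (((((Commute.refl u).smul_left _).smul_right _).cesaro_right N).symm.cesaro_right N).symm

theorem commute_star_fourierColumn (hu : u ∈ unitary A) (r s : ZMod N) :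
    Commute (star (fourierColumn N u r)) (fourierColumn N u s) := by
  have h : Commute (star u) u := by
    rw [Commute, SemiconjBy, Unitary.star_mul_self_of_mem hu, Unitary.mul_star_self_of_mem hu]
  have h1 : Commute (star u) (fourierColumn N u r) := (h.smul_right _).cesaro_right N
  have h2 := h1.star_star
  rw [star_star] at h2
  exact (h2.symm.smul_right _).cesaro_right N

/-- The second moment of the partition `b_r^* b_r`. As `ζ_r^N = 1`, telescoping makes all `N`
summands equal to `N⁻² |u^N - 1|²`. -/
theorem sum_star_fourierColumn_conj (u : A) :
    ∑ r, star (fourierColumn N u r) * (star ((ZMod.toCircle r : ℂ) • u - 1) *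
      ((ZMod.toCircle r : ℂ) • u - 1)) * fourierColumn N u r =
      (N : ℂ)⁻¹ • (star (u ^ N - 1) * (u ^ N - 1)) := by
  have h : ∀ r : ZMod N, star (fourierColumn N u r) * (star ((ZMod.toCircle r : ℂ) • u - 1) *
      ((ZMod.toCircle r : ℂ) • u - 1)) * fourierColumn N u r =
      ((N : ℂ)⁻¹ * (N : ℂ)⁻¹) • (star (u ^ N - 1) * (u ^ N - 1)) := by
    intro r
    have e := sub_one_mul_cesaro N ((ZMod.toCircle r : ℂ) • u)
    rw [smul_pow, toCircle_pow_card, one_smul] at e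
    calc _ = star (((ZMod.toCircle r : ℂ) • u - 1) * fourierColumn N u r) *
          (((ZMod.toCircle r : ℂ) • u - 1) * fourierColumn N u r) := by
          rw [star_mul]; simp only [mul_assoc]
      _ = _ := by
          rw [fourierColumn, e, star_smul, smul_mul_smul_comm, star_inv₀, star_natCast]
  have hN : (N : ℂ) ≠ 0 := NeZero.ne _
  simp only [h, Finset.sum_const, Finset.card_univ, ZMod.card]
  rw [← Nat.cast_smul_eq_nsmul ℂ, smul_smul, mul_inv_cancel_left₀ hN]

theorem commute_unitary_pow_fourierColumn (u : A) (k : ℕ) (s : ZMod N) :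
    Commute (u ^ k - 1) (fourierColumn N u s) :=
  ((((Commute.refl u).pow_left k).sub_left (Commute.one_left u)).smul_right _).cesaro_right N

end FourierColumn

/-! ### Averaging along a unitary -/

section Compress

variable {A : Type*} [CStarAlgebra A] {N : ℕ} [NeZero N] {u : A}

/-- The compression of the diagonal operator `X` by the column `fourierColumn N u`. -/
noncomputable def compress (u : A) (X : ZMod N → A) : A :=
  ∑ r, star (fourierColumn N u r) * X r * fourierColumn N u r

theorem norm_mul_le_of_left {a x : A} (ha : ‖a‖ ≤ 1) : ‖a * x‖ ≤ ‖x‖ :=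
  (norm_mul_le _ _).trans (mul_le_of_le_one_left (norm_nonneg _) ha)

theorem norm_mul_le_of_right {a x : A} (ha : ‖a‖ ≤ 1) : ‖x * a‖ ≤ ‖x‖ :=
  (norm_mul_le _ _).trans (mul_le_of_le_one_right (norm_nonneg _) ha)

theorem norm_star_mul_sub (a x : A) : ‖star a * x - x * star a‖ = ‖a * star x - star x * a‖ := by
  rw [← norm_star, star_sub, star_mul, star_mul, star_star, norm_sub_rev]

theorem norm_fourierColumn_mul_sub_le [Nontrivial A] (hu : u ∈ unitary A) (r : ZMod N) (a : A) :
    ‖fourierColumn N u r * a - a * fourierColumn N u r‖ ≤ N * ‖u * a - a * u‖ := by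
  refine (norm_cesaro_mul_sub_le N (norm_toCircle_smul_le hu _) a).trans (le_of_eq ?_)
  rw [smul_mul_assoc, mul_smul_comm, ← smul_sub, norm_smul, Circle.norm_coe, one_mul]

theorem compress_const_one (hu : u ∈ unitary A) : compress u (fun _ : ZMod N => (1 : A)) = 1 := by
  simp [compress, sum_star_fourierColumn_mul hu]

theorem sum_compress {ι : Type*} [Fintype ι] (X : ι → ZMod N → A) :
    ∑ k, compress u (X k) = compress u fun r => ∑ k, X k r := by
  simp only [compress]
  rw [Finset.sum_comm]
  simp only [Finset.mul_sum, Finset.sum_mul]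

theorem isSelfAdjoint_compress {X : ZMod N → A} (hX : ∀ r, IsSelfAdjoint (X r)) :
    IsSelfAdjoint (compress u X) :=
  isSelfAdjoint_sum _ fun r _ => (hX r).conjugate' _

theorem norm_compress_le [Nontrivial A] (hu : u ∈ unitary A) {X : ZMod N → A} {t : ℝ}
    (ht : 0 ≤ t) (hX : ∀ r, ‖X r‖ ≤ t) : ‖compress u X‖ ≤ 2 * t :=
  norm_sum_conj_le_of_sum_eq_one _ _ (sum_star_fourierColumn_mul hu) hX ht

/-- With `x_r = ζ_r u - 1` one has `|ζ_r - ζ_s|² = |x_r - x_s|² ≤ 2(|x_r|² + |x_s|²)`. Each of the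
two terms sums to the second moment, of norm at most `4/N`, which gives `2C · 8/N`. -/
theorem norm_sum_sum_smul_le [Nontrivial A] (hu : u ∈ unitary A) {δ C : ℝ} (hδ : 0 ≤ δ)
    (hC : 0 ≤ C) :
    ‖∑ p : ZMod N × ZMod N, ((δ + C * ‖(ZMod.toCircle p.1 : ℂ) - ZMod.toCircle p.2‖ ^ 2 : ℝ) : ℂ) •
      (star (fourierColumn N u p.1 * fourierColumn N u p.2) *
        (fourierColumn N u p.1 * fourierColumn N u p.2))‖ ≤ δ + C * (16 / N) := by
  let _ := CStarAlgebra.spectralOrder A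
  let _ := CStarAlgebra.spectralOrderedRing A
  set b := fourierColumn N u
  set z : ZMod N → ℂ := fun r => ZMod.toCircle r
  set x : ZMod N → A := fun r => z r • u - 1
  set D : A := (N : ℂ)⁻¹ • (star (u ^ N - 1) * (u ^ N - 1))
  have hDb : ∀ s, star (b s) * D * b s = D * (star (b s) * b s) := by
    intro s
    have h1 : Commute (u ^ N - 1) (star (b s)) := by
      have h2 : Commute u (star (b s)) := by
        have hs : Commute (star u) u := by
          rw [Commute, SemiconjBy, Unitary.star_mul_self_of_mem hu,
            Unitary.mul_star_self_of_mem hu]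
        have h3 : Commute (star u) (b s) := (hs.smul_right _).cesaro_right N
        have h4 := h3.star_star
        rwa [star_star] at h4
      exact (h2.pow_left N).sub_left (Commute.one_left _)
    have h2 : Commute (star (u ^ N - 1)) (star (b s)) :=
      (commute_unitary_pow_fourierColumn u N s).star_star
    have h3 : Commute D (star (b s)) := (h2.mul_left h1).smul_left _
    rw [← h3.eq, mul_assoc]
  have hD : ‖D‖ ≤ 4 / N := by
    have h1 : ‖u ^ N - 1‖ ≤ 2 := by
      refine (norm_sub_le _ _).trans ?_
      rw [CStarRing.norm_of_mem_unitary (pow_mem hu N), norm_one]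
      norm_num
    rw [norm_smul, norm_inv, Complex.norm_natCast, CStarRing.norm_star_mul_self, div_eq_inv_mul]
    refine mul_le_mul_of_nonneg_left ?_ (by positivity)
    nlinarith [norm_nonneg (u ^ N - 1)]
  have hsum1 : ∑ r, star (b r) * b r = 1 := sum_star_fourierColumn_mul hu
  have hsum2 : ∑ r, star (b r) * (star (x r) * x r) * b r = D := sum_star_fourierColumn_conj u
  have hcomm : ∀ r s, b r * b s = b s * b r := fun r s => (commute_fourierColumn u r s).eq
  have hterm : ∀ p : ZMod N × ZMod N,
      ((δ + C * ‖z p.1 - z p.2‖ ^ 2 : ℝ) : ℂ) • (star (b p.1 * b p.2) * (b p.1 * b p.2)) ≤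
        (δ : ℂ) • (star (b p.2) * (star (b p.1) * b p.1) * b p.2) + ((2 * C : ℝ) : ℂ) •
          (star (b p.2) * (star (b p.1) * (star (x p.1) * x p.1) * b p.1) * b p.2 +
            star (b p.1) * (star (b p.2) * (star (x p.2) * x p.2) * b p.2) * b p.1) := by
    intro p
    set c := b p.1 * b p.2
    have e1 : star (b p.2) * (star (b p.1) * b p.1) * b p.2 = star c * c := by
      simp only [c, star_mul, mul_assoc]
    have e2 : star (b p.2) * (star (b p.1) * (star (x p.1) * x p.1) * b p.1) * b p.2 =
        star c * (star (x p.1) * x p.1) * c := by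
      simp only [c, star_mul, mul_assoc]
    have e3 : star (b p.1) * (star (b p.2) * (star (x p.2) * x p.2) * b p.2) * b p.1 =
        star c * (star (x p.2) * x p.2) * c := by
      simp only [c, hcomm p.1 p.2, star_mul, mul_assoc]
    have e4 : (‖z p.1 - z p.2‖ ^ 2 : ℝ) • (1 : A) = star (x p.1 - x p.2) * (x p.1 - x p.2) := by
      have : x p.1 - x p.2 = (z p.1 - z p.2) • u := by simp only [x, sub_smul]; abel
      rw [this, star_smul, smul_mul_smul_comm, Unitary.star_mul_self_of_mem hu, ← Complex.coe_smul]
      congr 1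
      rw [Complex.star_def, mul_comm, Complex.mul_conj, Complex.normSq_eq_norm_sq]
    have e5 : star (x p.1 - x p.2) * (x p.1 - x p.2) ≤
        (2 : ℝ) • (star (x p.1) * x p.1 + star (x p.2) * x p.2) := by
      rw [← sub_nonneg]
      convert star_mul_self_nonneg (x p.1 + x p.2) using 1
      simp only [star_add, star_sub, two_smul, mul_add, add_mul, mul_sub, sub_mul]
      abel
    have e6 := star_left_conjugate_le_conjugate (e4.trans_le e5) c
    rw [e1, e2, e3, ← add_mul, ← mul_add]
    have e7 : star c * ((‖z p.1 - z p.2‖ ^ 2 : ℝ) • (1 : A)) * c =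
        (‖z p.1 - z p.2‖ ^ 2 : ℝ) • (star c * c) := by
      rw [mul_smul_comm, smul_mul_assoc, mul_one]
    rw [e7] at e6
    have e8 := smul_le_smul_of_nonneg_left e6 hC
    rw [mul_smul_comm, smul_mul_assoc, smul_smul, smul_smul] at e8
    rw [Complex.coe_smul, Complex.coe_smul, Complex.coe_smul, add_smul, mul_comm 2 C]
    exact add_le_add le_rfl e8
  have hS : ∑ p : ZMod N × ZMod N,
        ((δ : ℂ) • (star (b p.2) * (star (b p.1) * b p.1) * b p.2) + ((2 * C : ℝ) : ℂ) •
          (star (b p.2) * (star (b p.1) * (star (x p.1) * x p.1) * b p.1) * b p.2 +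
            star (b p.1) * (star (b p.2) * (star (x p.2) * x p.2) * b p.2) * b p.1)) =
      (δ : ℂ) • 1 + ((2 * C : ℝ) : ℂ) • (D + D) := by
    rw [Finset.sum_add_distrib, ← Finset.smul_sum, ← Finset.smul_sum, Finset.sum_add_distrib]
    congr 2
    · rw [Fintype.sum_prod_type_right]
      simp only [← Finset.mul_sum, ← Finset.sum_mul, hsum1, mul_one]
    · congr 1
      · rw [Fintype.sum_prod_type_right]
        simp only [← Finset.mul_sum, ← Finset.sum_mul, hsum2, hDb, hsum1, mul_one]
      · rw [Fintype.sum_prod_type]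
        simp only [← Finset.mul_sum, ← Finset.sum_mul, hsum2, hDb, hsum1, mul_one]
  have h1 := Finset.sum_le_sum fun p (_ : p ∈ (Finset.univ : Finset (ZMod N × ZMod N))) => hterm p
  rw [hS] at h1
  refine (CStarAlgebra.norm_le_norm_of_nonneg_of_le ?_ h1).trans ?_
  · refine Finset.sum_nonneg fun p _ => ?_
    rw [Complex.coe_smul]
    exact smul_nonneg (by positivity) (star_mul_self_nonneg _)
  · refine (norm_add_le _ _).trans ?_
    rw [norm_smul, norm_smul, norm_one, Complex.norm_real, Complex.norm_real,
      Real.norm_of_nonneg hδ, Real.norm_of_nonneg (by positivity), mul_one]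
    have h2 : ‖D + D‖ ≤ 8 / N := by
      refine (norm_add_le _ _).trans ((add_le_add hD hD).trans (le_of_eq ?_))
      ring
    have h3 : 2 * C * ‖D + D‖ ≤ 2 * C * (8 / N) := mul_le_mul_of_nonneg_left h2 (by positivity)
    have h4 : 2 * C * (8 / N) = C * (16 / N) := by ring
    linarith

/-- Write both sides as double sums over `(r, s)`. Regrouping the `b`'s around `X` and `Y` costs
`2Nη` for each of the `N²` pairs, once on each side. In between, `Y_s` is exchanged for `Y_r` inside
the column `(b_r b_s)`: the weights at distant `r, s` are controlled by the second moment, which is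
why the modulus of continuity of `Y` is taken quadratic. -/
theorem norm_compress_mul_sub_le [Nontrivial A] (hu : u ∈ unitary A) {X Y : ZMod N → A}
    (hX : ∀ r, ‖X r‖ ≤ 1) (hY : ∀ r, ‖Y r‖ ≤ 1) (hXs : ∀ r, IsSelfAdjoint (X r))
    (hYs : ∀ r, IsSelfAdjoint (Y r)) {δ C η : ℝ} (hδ : 0 ≤ δ) (hC : 0 ≤ C)
    (hXu : ∀ r, ‖u * X r - X r * u‖ ≤ η) (hYu : ∀ r, ‖u * Y r - Y r * u‖ ≤ η)
    (hYc : ∀ r s, ‖Y s - Y r‖ ≤ δ + C * ‖(ZMod.toCircle r : ℂ) - ZMod.toCircle s‖ ^ 2) :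
    ‖compress u X * compress u Y - compress u fun r => X r * Y r‖ ≤
      4 * N ^ 3 * η + 2 * (δ + C * (16 / N)) := by
  set b := fourierColumn N u
  have hb : ∀ r, ‖b r‖ ≤ 1 := norm_fourierColumn_le hu
  have hb' : ∀ r, ‖star (b r)‖ ≤ 1 := fun r => by rw [norm_star]; exact hb r
  have hN : (0 : ℝ) ≤ N := by positivity
  have cY : ∀ r s, ‖b r * Y s - Y s * b r‖ ≤ N * η := fun r s =>
    (norm_fourierColumn_mul_sub_le hu r _).trans (mul_le_mul_of_nonneg_left (hYu s) hN)
  have cY' : ∀ r s, ‖Y s * star (b r) - star (b r) * Y s‖ ≤ N * η := fun r s => by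
    rw [norm_sub_rev, norm_star_mul_sub, (hYs s).star_eq]; exact cY r s
  have cX' : ∀ r s, ‖X s * star (b r) - star (b r) * X s‖ ≤ N * η := fun r s => by
    rw [norm_sub_rev, norm_star_mul_sub, (hXs s).star_eq]
    exact (norm_fourierColumn_mul_sub_le hu r _).trans (mul_le_mul_of_nonneg_left (hXu s) hN)
  have hbb : ∀ r s, b r * b s = b s * b r := fun r s => (commute_fourierColumn u r s).eq
  have hbs : ∀ r s, star (b r) * b s = b s * star (b r) := fun r s =>
    (commute_star_fourierColumn hu r s).eq
  have hss : ∀ r s, star (b r) * star (b s) = star (b s) * star (b r) := fun r s =>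
    (commute_fourierColumn u r s).star_star.eq
  have hsum1 : ∑ r, star (b r) * b r = 1 := sum_star_fourierColumn_mul hu
  set T1 : ZMod N × ZMod N → A := fun p =>
    star (b p.1) * X p.1 * b p.1 * (star (b p.2) * Y p.2 * b p.2)
  set T4 : ZMod N × ZMod N → A := fun p =>
    star (b p.1) * (X p.1 * Y p.1) * b p.1 * (star (b p.2) * b p.2)
  set T2 : ZMod N × ZMod N → A := fun p =>
    star (b p.1 * b p.2) * (X p.1 * Y p.2) * (b p.1 * b p.2)
  set T3 : ZMod N × ZMod N → A := fun p =>
    star (b p.1 * b p.2) * (X p.1 * Y p.1) * (b p.1 * b p.2)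
  have e1 : compress u X * compress u Y = ∑ p, T1 p := by
    rw [compress, compress, Finset.sum_mul_sum, Fintype.sum_prod_type]
  have e4 : (compress u fun r => X r * Y r) = ∑ p, T4 p := by
    rw [Fintype.sum_prod_type]
    simp only [T4, ← Finset.mul_sum, hsum1, mul_one, compress, b]
  have h12 : ∀ p, ‖T1 p - T2 p‖ ≤ 2 * (N * η) := by
    rintro ⟨r, s⟩
    have e : T1 (r, s) - T2 (r, s) =
        star (b r) * (X r * star (b s) - star (b s) * X r) * b r * Y s * b s +
        star (b r) * (star (b s) * (X r * ((b r * Y s - Y s * b r) * b s))) := by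
      have e' : star (b r) * X r * b r * (star (b s) * Y s * b s) =
          star (b r) * X r * (b r * star (b s)) * Y s * b s := by simp only [mul_assoc]
      simp only [T1, T2, e', ← hbs s r, star_mul, ← hss r s]
      simp only [mul_sub, sub_mul, mul_assoc]
      abel
    rw [e]
    refine (norm_add_le _ _).trans ?_
    have g1 : ‖star (b r) * (X r * star (b s) - star (b s) * X r) * b r * Y s * b s‖ ≤ N * η :=
      (norm_mul_le_of_right (hb s)).trans <| (norm_mul_le_of_right (hY s)).trans <|
      (norm_mul_le_of_right (hb r)).trans <| (norm_mul_le_of_left (hb' r)).trans (cX' s r)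
    have g2 : ‖star (b r) * (star (b s) * (X r * ((b r * Y s - Y s * b r) * b s)))‖ ≤ N * η :=
      (norm_mul_le_of_left (hb' r)).trans <| (norm_mul_le_of_left (hb' s)).trans <|
      (norm_mul_le_of_left (hX r)).trans <| (norm_mul_le_of_right (hb s)).trans (cY r s)
    linarith
  have h34 : ∀ p, ‖T3 p - T4 p‖ ≤ 2 * (N * η) := by
    rintro ⟨r, s⟩
    have e : T3 (r, s) - T4 (r, s) =
        -(star (b r) * (X r * (Y r * star (b s) - star (b s) * Y r)) * b s * b r +
        star (b r) * (X r * star (b s) - star (b s) * X r) * Y r * b s * b r) := by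
      have e' : b r * (star (b s) * b s) = star (b s) * b s * b r := by
        rw [← mul_assoc, ← hbs, mul_assoc, hbb, mul_assoc]
      have e'' : star (b r) * (X r * Y r) * b r * (star (b s) * b s) =
        star (b r) * (X r * Y r) * (star (b s) * b s * b r) := by rw [mul_assoc _ (b r), e']
      simp only [T3, T4, e'', star_mul, hss s r, hbb r s]
      simp only [mul_sub, sub_mul, mul_assoc]
      abel
    rw [e, norm_neg]
    refine (norm_add_le _ _).trans ?_
    have g1 : ‖star (b r) * (X r * (Y r * star (b s) - star (b s) * Y r)) * b s * b r‖ ≤ N * η :=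
      (norm_mul_le_of_right (hb r)).trans <| (norm_mul_le_of_right (hb s)).trans <|
      (norm_mul_le_of_left (hb' r)).trans <| (norm_mul_le_of_left (hX r)).trans (cY' s r)
    have g2 : ‖star (b r) * (X r * star (b s) - star (b s) * X r) * Y r * b s * b r‖ ≤ N * η :=
      (norm_mul_le_of_right (hb r)).trans <| (norm_mul_le_of_right (hb s)).trans <|
      (norm_mul_le_of_right (hY r)).trans <| (norm_mul_le_of_left (hb' r)).trans (cX' s r)
    linarith
  have h23 : ‖∑ p, (T2 p - T3 p)‖ ≤ 2 * (δ + C * (16 / N)) := by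
    have e : ∀ p, T2 p - T3 p =
        star (b p.1 * b p.2) * (X p.1 * (Y p.2 - Y p.1)) * (b p.1 * b p.2) := by
      intro p
      simp only [T2, T3, mul_sub, sub_mul]
    simp only [e]
    refine (norm_sum_conj_le (fun p : ZMod N × ZMod N => b p.1 * b p.2)
      (fun p => X p.1 * (Y p.2 - Y p.1)) (fun p =>
        δ + C * ‖(ZMod.toCircle p.1 : ℂ) - ZMod.toCircle p.2‖ ^ 2) fun p =>
        (norm_mul_le_of_left (hX _)).trans (hYc _ _)).trans ?_
    exact mul_le_mul_of_nonneg_left (norm_sum_sum_smul_le hu hδ hC) zero_le_two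
  have hcard : ∀ f : ZMod N × ZMod N → A, (∀ p, ‖f p‖ ≤ 2 * (N * η)) →
      ‖∑ p, f p‖ ≤ 2 * N ^ 3 * η := by
    intro f hf
    refine (norm_sum_le_of_le _ fun p _ => hf p).trans (le_of_eq ?_)
    simp only [Finset.sum_const, Finset.card_univ, Fintype.card_prod, ZMod.card, nsmul_eq_mul]
    push_cast
    ring
  have e : compress u X * compress u Y - (compress u fun r => X r * Y r) =
      ∑ p, (T1 p - T2 p) + ∑ p, (T2 p - T3 p) + ∑ p, (T3 p - T4 p) := by
    rw [e1, e4]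
    simp only [Finset.sum_sub_distrib]
    abel
  rw [e]
  refine (norm_add₃_le).trans ?_
  have g1 := hcard _ h12
  have g2 := hcard _ h34
  linarith

/-- Commutators with `b_r` and `b_r^*` are paid termwise, hence `N²`; the commutators `[X_r, a]` are
themselves compressed and cost no factor of `N`. The bound on `[u, a^*]` controls `[b_r^*, a]`. -/
theorem norm_compress_commutator_le [Nontrivial A] (hu : u ∈ unitary A) {X : ZMod N → A}
    (hX : ∀ r, ‖X r‖ ≤ 1) {a : A} {η c : ℝ} (hc : 0 ≤ c) (ha : ‖u * a - a * u‖ ≤ η)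
    (ha' : ‖u * star a - star a * u‖ ≤ η) (hXa : ∀ r, ‖X r * a - a * X r‖ ≤ c) :
    ‖compress u X * a - a * compress u X‖ ≤ 2 * N ^ 2 * η + 2 * c := by
  set b := fourierColumn N u
  have hb : ∀ r, ‖b r‖ ≤ 1 := norm_fourierColumn_le hu
  have hb' : ∀ r, ‖star (b r)‖ ≤ 1 := fun r => by rw [norm_star]; exact hb r
  have hN : (0 : ℝ) ≤ N := by positivity
  have c1 : ∀ r, ‖b r * a - a * b r‖ ≤ N * η := fun r =>
    (norm_fourierColumn_mul_sub_le hu r _).trans (mul_le_mul_of_nonneg_left ha hN)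
  have c2 : ∀ r, ‖star (b r) * a - a * star (b r)‖ ≤ N * η := fun r => by
    rw [norm_star_mul_sub]
    exact (norm_fourierColumn_mul_sub_le hu r _).trans (mul_le_mul_of_nonneg_left ha' hN)
  have e : compress u X * a - a * compress u X =
      ∑ r, (star (b r) * (X r * (b r * a - a * b r)) +
        (star (b r) * a - a * star (b r)) * X r * b r) +
      compress u fun r => X r * a - a * X r := by
    simp only [compress]
    rw [Finset.sum_mul, Finset.mul_sum, ← Finset.sum_sub_distrib, ← Finset.sum_add_distrib]
    refine Finset.sum_congr rfl fun r _ => ?_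
    simp only [b, mul_sub, sub_mul, mul_assoc]
    abel
  rw [e]
  refine (norm_add_le _ _).trans (add_le_add ?_ (norm_compress_le hu hc hXa))
  refine (norm_sum_le_of_le (f := fun r => star (b r) * (X r * (b r * a - a * b r)) +
        (star (b r) * a - a * star (b r)) * X r * b r) (n := fun _ => 2 * (N * η)) _
        fun r _ => ?_).trans (le_of_eq ?_)
  · refine (norm_add_le _ _).trans ?_
    have g1 : ‖star (b r) * (X r * (b r * a - a * b r))‖ ≤ N * η :=
      (norm_mul_le_of_left (hb' r)).trans <| (norm_mul_le_of_left (hX r)).trans (c1 r)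
    have g2 : ‖(star (b r) * a - a * star (b r)) * X r * b r‖ ≤ N * η :=
      (norm_mul_le_of_right (hb r)).trans <| (norm_mul_le_of_right (hX r)).trans (c2 r)
    linarith
  · simp only [Finset.sum_const, Finset.card_univ, ZMod.card, nsmul_eq_mul]
    ring

/-- From `β(ζ_r u) ≈ ζ_{r₀ + r} u` one gets `β(b_r) ≈ b_{r₀ + r}`, and the index shift disappears on
reindexing the sum. -/
theorem norm_map_compress_sub_le [Nontrivial A] (hu : u ∈ unitary A) (β : A →⋆ₐ[ℂ] A)
    {X Y : ZMod N → A} (hX : ∀ r, ‖X r‖ ≤ 1) (r₀ : ZMod N) {η : ℝ}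
    (hβ : ‖β u - (ZMod.toCircle r₀ : ℂ) • u‖ ≤ η) (hXY : ∀ r, β (X r) = Y (r₀ + r)) :
    ‖β (compress u X) - compress u Y‖ ≤ 2 * N ^ 2 * η := by
  set b := fourierColumn N u
  have hb : ∀ r, ‖b r‖ ≤ 1 := norm_fourierColumn_le hu
  have hN : (0 : ℝ) ≤ N := by positivity
  have hβn : ∀ x, ‖β x‖ ≤ ‖x‖ := fun x => NonUnitalStarAlgHom.norm_apply_le β x
  have c1 : ∀ r, ‖β (b r) - b (r₀ + r)‖ ≤ N * η := by
    intro r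
    have h1 : ‖(ZMod.toCircle r : ℂ) • β u‖ ≤ 1 := by
      rw [norm_smul, Circle.norm_coe, one_mul]
      exact (hβn u).trans (CStarRing.norm_of_mem_unitary hu).le
    have h2 : (ZMod.toCircle (r₀ + r) : ℂ) = ZMod.toCircle r * ZMod.toCircle r₀ := by
      rw [AddChar.map_add_eq_mul, Circle.coe_mul, mul_comm]
    simp only [b, fourierColumn]
    rw [map_cesaro, map_smul]
    refine (norm_cesaro_sub_le N h1 (norm_toCircle_smul_le hu _)).trans
      (mul_le_mul_of_nonneg_left ?_ hN)
    rwa [h2, mul_smul, ← smul_sub, norm_smul, Circle.norm_coe, one_mul]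
  have c2 : ∀ r, ‖star (β (b r)) - star (b (r₀ + r))‖ ≤ N * η := fun r => by
    rw [← star_sub, norm_star]; exact c1 r
  have e : β (compress u X) - compress u Y =
      ∑ r, ((star (β (b r)) - star (b (r₀ + r))) * β (X r) * β (b r) +
        star (b (r₀ + r)) * (β (X r) * (β (b r) - b (r₀ + r)))) := by
    have e1 : compress u Y = ∑ r, star (b (r₀ + r)) * β (X r) * b (r₀ + r) := by
      simp only [hXY]
      exact (Equiv.sum_comp (Equiv.addLeft r₀) fun r => star (b r) * Y r * b r).symm
    rw [e1]
    simp only [compress, map_sum, map_mul, map_star]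
    rw [← Finset.sum_sub_distrib]
    refine Finset.sum_congr rfl fun r _ => ?_
    simp only [b, mul_sub, sub_mul, mul_assoc]
    abel
  rw [e]
  refine (norm_sum_le_of_le (n := fun _ => 2 * (N * η)) _ fun r _ => ?_).trans (le_of_eq ?_)
  · refine (norm_add_le _ _).trans ?_
    have g1 : ‖(star (β (b r)) - star (b (r₀ + r))) * β (X r) * β (b r)‖ ≤ N * η :=
      (norm_mul_le_of_right ((hβn _).trans (hb r))).trans <|
        (norm_mul_le_of_right ((hβn _).trans (hX r))).trans (c2 r)
    have g2 : ‖star (b (r₀ + r)) * (β (X r) * (β (b r) - b (r₀ + r)))‖ ≤ N * η :=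
      (norm_mul_le_of_left (by rw [norm_star]; exact hb _)).trans <|
        (norm_mul_le_of_left ((hβn _).trans (hX r))).trans (c1 r)
    linarith
  · simp only [Finset.sum_const, Finset.card_univ, ZMod.card, nsmul_eq_mul]
    ring

end Compress

/-! ### From central matrix units to Rokhlin projections -/

/-- Every finite subset of `A` almost commutes with a unital copy of `M_n`. -/
def HasCentralMatrixUnits (n : ℕ) (A : Type*) [CStarAlgebra A] : Prop :=
  ∀ (F : Finset A) (ε : ℝ), 0 < ε → ∃ φ : Matrix (Fin n) (Fin n) ℂ →⋆ₐ[ℂ] A,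
    ∀ i j, ∀ a ∈ F, ‖φ (Matrix.single i j 1) * a - a * φ (Matrix.single i j 1)‖ < ε

theorem norm_map_single_le {n : ℕ} {A : Type*} [CStarAlgebra A]
    (φ : Matrix (Fin n) (Fin n) ℂ →⋆ₐ[ℂ] A) (i j : Fin n) : ‖φ (Matrix.single i j 1)‖ ≤ 1 := by
  have h1 : IsStarProjection (φ (Matrix.single j j 1)) := by
    refine ⟨?_, ?_⟩
    · rw [IsIdempotentElem, ← map_mul, Matrix.single_mul_single_same, one_mul]
    · rw [IsSelfAdjoint, ← map_star, Matrix.star_eq_conjTranspose,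
        Matrix.conjTranspose_single, star_one]
  have h2 : star (φ (Matrix.single i j 1)) * φ (Matrix.single i j 1) =
      φ (Matrix.single j j 1) := by
    rw [← map_star, ← map_mul, Matrix.star_eq_conjTranspose, Matrix.conjTranspose_single,
      star_one, Matrix.single_mul_single_same, one_mul]
  have h3 := h1.norm_le
  rw [← h2, CStarRing.norm_star_mul_self] at h3
  nlinarith [norm_nonneg (φ (Matrix.single i j 1))]

theorem star_map_single {n : ℕ} {A : Type*} [CStarAlgebra A]
    (φ : Matrix (Fin n) (Fin n) ℂ →⋆ₐ[ℂ] A) (i j : Fin n) :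
    star (φ (Matrix.single i j 1)) = φ (Matrix.single j i 1) := by
  rw [← map_star, Matrix.star_eq_conjTranspose, Matrix.conjTranspose_single, star_one]

/-! ### A circle of rank-one projections in `M_n` -/

section RootProjection

variable {n : ℕ}

/-- The projection onto the line spanned by `(1, ζ, …, ζ^{n-1})`. -/
noncomputable def rootProjection (n : ℕ) (ζ : Circle) : Matrix (Fin n) (Fin n) ℂ :=
  Matrix.of fun i j => (n : ℂ)⁻¹ * ((ζ : ℂ) ^ (i : ℕ) * star (ζ : ℂ) ^ (j : ℕ))

theorem star_coe_mul_coe (ζ : Circle) : star (ζ : ℂ) * (ζ : ℂ) = 1 := by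
  rw [Complex.star_def, ← Circle.coe_inv_eq_conj, ← Circle.coe_mul, inv_mul_cancel, Circle.coe_one]

/-- The inner product of the two defining vectors is a character sum over `Fin n`; the common factor
`ζ` has modulus one and drops out. -/
theorem rootProjection_mul [NeZero n] (ζ : Circle) (g h : ZMod n) :
    rootProjection n (ζ * (ZMod.toCircle g)⁻¹) * rootProjection n (ζ * (ZMod.toCircle h)⁻¹) =
      if g = h then rootProjection n (ζ * (ZMod.toCircle g)⁻¹) else 0 := by
  have hn : (n : ℂ) ≠ 0 := NeZero.ne _
  have key : ∑ l : Fin n, star ((ζ * (ZMod.toCircle g)⁻¹ : Circle) : ℂ) ^ (l : ℕ) *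
      ((ζ * (ZMod.toCircle h)⁻¹ : Circle) : ℂ) ^ (l : ℕ) = if g = h then (n : ℂ) else 0 := by
    rw [← sum_range_toCircle_pow_mul_star_pow g h, Finset.sum_range]
    refine Finset.sum_congr rfl fun l _ => ?_
    rw [← mul_pow, ← mul_pow]
    congr 1
    simp only [Circle.coe_mul, Circle.coe_inv_eq_conj, star_mul, Complex.star_def,
      Complex.conj_conj]
    have := star_coe_mul_coe ζ
    rw [Complex.star_def] at this
    linear_combination (ZMod.toCircle g : ℂ) * (starRingEnd ℂ) (ZMod.toCircle h : ℂ) * this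
  ext i j
  have e : (rootProjection n (ζ * (ZMod.toCircle g)⁻¹) *
      rootProjection n (ζ * (ZMod.toCircle h)⁻¹)) i j =
      ((n : ℂ)⁻¹ * (n : ℂ)⁻¹ * ((ζ * (ZMod.toCircle g)⁻¹ : Circle) : ℂ) ^ (i : ℕ) *
        star ((ζ * (ZMod.toCircle h)⁻¹ : Circle) : ℂ) ^ (j : ℕ)) *
      ∑ l : Fin n, star ((ζ * (ZMod.toCircle g)⁻¹ : Circle) : ℂ) ^ (l : ℕ) *
      ((ζ * (ZMod.toCircle h)⁻¹ : Circle) : ℂ) ^ (l : ℕ) := by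
    rw [Matrix.mul_apply, Finset.mul_sum]
    refine Finset.sum_congr rfl fun l _ => ?_
    simp only [rootProjection, Matrix.of_apply]
    ring
  rw [e, key]
  split_ifs with hgh
  · subst hgh
    simp only [rootProjection, Matrix.of_apply]
    field_simp
  · simp

theorem sum_rootProjection [NeZero n] (ζ : Circle) :
    ∑ g : ZMod n, rootProjection n (ζ * (ZMod.toCircle g)⁻¹) = 1 := by
  have hn : (n : ℂ) ≠ 0 := NeZero.ne _
  ext i j
  have h1 : ∀ g : ZMod n, rootProjection n (ζ * (ZMod.toCircle g)⁻¹) i j =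
      ((n : ℂ)⁻¹ * ((ζ : ℂ) ^ (i : ℕ) * star (ζ : ℂ) ^ (j : ℕ))) *
      (star (ZMod.toCircle g : ℂ) ^ (i : ℕ) * (ZMod.toCircle g : ℂ) ^ (j : ℕ)) := by
    intro g
    simp only [rootProjection, Matrix.of_apply, Circle.coe_mul, Circle.coe_inv_eq_conj, star_mul,
      Complex.star_def, Complex.conj_conj, mul_pow]
    ring
  rw [Matrix.sum_apply]
  simp only [h1]
  rw [← Finset.mul_sum, sum_star_toCircle_pow_mul_pow i.2 j.2, Matrix.one_apply]
  by_cases h : i = j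
  · subst h
    have := star_coe_mul_coe ζ
    rw [if_pos rfl, if_pos rfl, ← mul_pow, mul_comm (ζ : ℂ), this, one_pow]
    field_simp
  · rw [if_neg h, if_neg (fun h' => h (Fin.ext h')), mul_zero]

theorem star_rootProjection (ζ : Circle) : star (rootProjection n ζ) = rootProjection n ζ := by
  ext i j
  simp only [rootProjection, Matrix.star_apply, Matrix.of_apply, star_mul', star_pow, star_star,
    star_inv₀, star_natCast]
  ring

theorem rootProjection_eq_sum (ζ : Circle) : rootProjection n ζ =
    ∑ i, ∑ j, rootProjection n ζ i j • Matrix.single i j (1 : ℂ) := by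
  conv_lhs => rw [Matrix.matrix_eq_sum_single (rootProjection n ζ)]
  simp [Matrix.smul_single]

theorem norm_rootProjection_apply (ζ : Circle) (i j : Fin n) :
    ‖rootProjection n ζ i j‖ = (n : ℝ)⁻¹ := by
  simp [rootProjection, Circle.norm_coe]

theorem continuous_rootProjection_apply (i j : Fin n) :
    Continuous fun ζ : Circle => rootProjection n ζ i j := by
  simp only [rootProjection, Matrix.of_apply]
  fun_prop

end RootProjection

/-- Makes `ℤ_n` act on the grid of `N`-th roots of unity by index shifts, as
`norm_map_compress_sub_le` requires. -/
theorem exists_toCircle_eq {n N : ℕ} [NeZero n] [NeZero N] (h : n ∣ N) (g : ZMod n) :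
    ∃ r : ZMod N, ZMod.toCircle r = ZMod.toCircle g := by
  obtain ⟨m, rfl⟩ := h
  have hm : (m : ℂ) ≠ 0 := by
    have : n * m ≠ 0 := NeZero.ne _
    exact_mod_cast (mul_ne_zero_iff.mp this).2
  have hn : (n : ℂ) ≠ 0 := NeZero.ne _
  refine ⟨((m * g.val : ℕ) : ZMod (n * m)), Circle.ext ?_⟩
  rw [ZMod.toCircle_natCast, ZMod.toCircle_apply]
  congr 1
  push_cast
  field_simp

/-! ### Construction of the Rokhlin projections -/

section Rokhlin

variable {A : Type*} [CStarAlgebra A]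

theorem norm_starAlgEquiv_apply (e : A ≃⋆ₐ[ℂ] A) (x : A) : ‖e x‖ = ‖x‖ :=
  NonUnitalStarAlgHom.norm_map e e.injective x

/-- There are `n²` matrix entries, each of modulus `1/n`. -/
theorem norm_map_rootProjection_commutator_le {n : ℕ} [NeZero n]
    (φ : Matrix (Fin n) (Fin n) ℂ →⋆ₐ[ℂ] A) (ζ : Circle) {a : A} {c : ℝ}
    (h : ∀ i j, ‖φ (Matrix.single i j 1) * a - a * φ (Matrix.single i j 1)‖ ≤ c) :
    ‖φ (rootProjection n ζ) * a - a * φ (rootProjection n ζ)‖ ≤ n * c := by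
  have e : φ (rootProjection n ζ) * a - a * φ (rootProjection n ζ) =
      ∑ i, ∑ j, rootProjection n ζ i j •
        (φ (Matrix.single i j 1) * a - a * φ (Matrix.single i j 1)) := by
    conv_lhs => rw [rootProjection_eq_sum ζ]
    simp only [map_sum, map_smul, Finset.sum_mul, Finset.mul_sum, smul_sub, smul_mul_assoc,
      mul_smul_comm, Finset.sum_sub_distrib]
  rw [e]
  refine (norm_sum_le_of_le (n := fun _ => c) _ fun i _ => ?_).trans (by simp)
  refine (norm_sum_le_of_le (n := fun _ => (n : ℝ)⁻¹ * c) _ fun j _ => ?_).trans ?_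
  · rw [norm_smul, norm_rootProjection_apply]
    exact mul_le_mul_of_nonneg_left (h i j) (by positivity)
  · have hn : (n : ℝ) ≠ 0 := NeZero.ne _
    simp only [Finset.sum_const, Finset.card_univ, Fintype.card_fin, nsmul_eq_mul]
    rw [mul_inv_cancel_left₀ hn]

/-- In a compact orbit, commutators can be made uniformly small. -/
theorem exists_central_on_orbits {n : ℕ} (hA : HasCentralMatrixUnits n A)
    (α : Circle →* (A ≃⋆ₐ[ℂ] A)) (hcont : ∀ a : A, Continuous fun ζ : Circle => α ζ a)
    (F : Finset A) {c : ℝ} (hc : 0 < c) :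
    ∃ φ : Matrix (Fin n) (Fin n) ℂ →⋆ₐ[ℂ] A, ∀ i j, ∀ a ∈ F, ∀ ζ : Circle,
      ‖φ (Matrix.single i j 1) * α ζ a - α ζ a * φ (Matrix.single i j 1)‖ ≤ c := by
  classical
  have hK : IsCompact (⋃ a ∈ F, Set.range fun ζ : Circle => α ζ a) :=
    F.finite_toSet.isCompact_biUnion fun a _ => isCompact_range (hcont a)
  obtain ⟨t, -, ht, hcov⟩ := hK.finite_cover_balls (e := c / 4) (by positivity)
  obtain ⟨φ, hφ⟩ := hA ht.toFinset (c / 4) (by positivity)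
  refine ⟨φ, fun i j a ha ζ => ?_⟩
  have hn : ‖φ (Matrix.single i j 1)‖ ≤ 1 := norm_map_single_le φ i j
  have hmem : α ζ a ∈ ⋃ a ∈ F, Set.range fun ζ : Circle => α ζ a :=
    Set.mem_biUnion ha ⟨ζ, rfl⟩
  obtain ⟨f, hf, hfa⟩ := Set.mem_iUnion₂.mp (hcov hmem)
  rw [Metric.mem_ball, dist_eq_norm] at hfa
  have h1 := hφ i j f (by simpa using hf)
  set p := φ (Matrix.single i j 1)
  have e : p * α ζ a - α ζ a * p = (p * f - f * p) + (p * (α ζ a - f) - (α ζ a - f) * p) := by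
    simp only [mul_sub, sub_mul]; abel
  rw [e]
  have h2 : ‖p * (α ζ a - f)‖ ≤ c / 4 := (norm_mul_le_of_left hn).trans hfa.le
  have h3 : ‖(α ζ a - f) * p‖ ≤ c / 4 := (norm_mul_le_of_right hn).trans hfa.le
  have h4 := norm_sub_le (p * (α ζ a - f)) ((α ζ a - f) * p)
  have h5 := norm_add_le (p * f - f * p) (p * (α ζ a - f) - (α ζ a - f) * p)
  linarith

/-- A continuous map on the circle is Lipschitz-like up to a small error. -/
theorem exists_modulus {E : Type*} [SeminormedAddCommGroup E] {f : Circle → E} (hf : Continuous f)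
    {B : ℝ} (hB : ∀ ζ, ‖f ζ‖ ≤ B) {δ : ℝ} (hδ : 0 < δ) :
    ∃ C : ℝ, 0 ≤ C ∧ ∀ ζ ξ : Circle, ‖f ξ - f ζ‖ ≤ δ + C * ‖(ζ : ℂ) - ξ‖ ^ 2 := by
  have hB0 : 0 ≤ B := (norm_nonneg _).trans (hB 1)
  have huc := CompactSpace.uniformContinuous_of_continuous hf
  obtain ⟨η, hη, h⟩ := Metric.uniformContinuous_iff.mp huc δ hδ
  -- Within distance `η` the error is at most `δ` by uniform continuity; beyond it the trivial bound
  -- `2B` is absorbed by the quadratic term.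
  refine ⟨2 * B / η ^ 2, by positivity, fun ζ ξ => ?_⟩
  have hd : dist ξ ζ = ‖(ζ : ℂ) - ξ‖ := by
    rw [norm_sub_rev, ← dist_eq_norm]
    rfl
  by_cases hlt : dist ξ ζ < η
  · have h1 := h hlt
    rw [dist_eq_norm] at h1
    have : 0 ≤ 2 * B / η ^ 2 * ‖(ζ : ℂ) - ξ‖ ^ 2 := by positivity
    linarith
  · rw [hd, not_lt] at hlt
    have h1 : ‖f ξ - f ζ‖ ≤ 2 * B := by
      have := norm_sub_le (f ξ) (f ζ)
      have h2 := hB ξ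
      have h3 := hB ζ
      linarith
    have h2 : η ^ 2 ≤ ‖(ζ : ℂ) - ξ‖ ^ 2 := pow_le_pow_left₀ hη.le hlt 2
    have h3 : 2 * B / η ^ 2 * η ^ 2 ≤ 2 * B / η ^ 2 * ‖(ζ : ℂ) - ξ‖ ^ 2 :=
      mul_le_mul_of_nonneg_left h2 (by positivity)
    rw [div_mul_cancel₀ _ (by positivity)] at h3
    linarith

/-- The order of choices matters: `φ` first, then the functions `E_g` and their modulus `C`, then
the grid size `N`, then the tolerance `η`, and last the unitary `u`, which must almost commute with
the finitely many grid values of the `E_g`. -/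
theorem finiteRokhlinProperty_of_hasCentralMatrixUnits [Nontrivial A]
    (α : Circle →* (A ≃⋆ₐ[ℂ] A)) (hcont : ∀ a : A, Continuous fun ζ : Circle => α ζ a)
    (hα : CircleRokhlinProperty α) (n : ℕ) [NeZero n] (hA : HasCentralMatrixUnits n A) :
    FiniteRokhlinProperty (restrictCyclic α n) := by
  classical
  intro F ε hε
  have hn0 : (0 : ℝ) < n := by exact_mod_cast Nat.pos_of_ne_zero (NeZero.ne n)
  set M : ℝ := 1 + ∑ a ∈ F, ‖a‖
  have hM : 1 ≤ M := le_add_of_nonneg_right (Finset.sum_nonneg fun _ _ => norm_nonneg _)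
  have hFM : ∀ a ∈ F, ‖a‖ ≤ M := fun a ha =>
    (Finset.single_le_sum (fun a _ => norm_nonneg a) ha).trans (by simp [M])
  set ε₁ : ℝ := ε / (8 * M)
  have hε₁ : 0 < ε₁ := by positivity
  have hε₁M : ε₁ * M = ε / 8 := by simp only [ε₁]; field_simp
  have hε₁' : ε₁ ≤ ε / 8 := by nlinarith
  obtain ⟨δ₀, hδ₀, hproj⟩ := exists_projections_near (A := A) (ι := Multiplicative (ZMod n)) hε₁
  obtain ⟨φ, hφ⟩ := exists_central_on_orbits hA α hcont F (c := ε / (8 * n)) (by positivity)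
  set κ : Multiplicative (ZMod n) → Circle := fun g => ZMod.toCircle (Multiplicative.toAdd g)
  have hκ : ∀ g h, κ (g * h) = κ g * κ h := fun g h => by
    simp only [κ, toAdd_mul, AddChar.map_add_eq_mul]
  have hres : ∀ g a, restrictCyclic α n g a = α (κ g) a := fun _ _ => rfl
  -- Applying `α_ζ` to `φ` yields exact equivariance: both `α_g(E_h(ζ))` and `E_{gh}(gζ)` equal
  -- `α_{gζ}(φ(P_{ζ h⁻¹}))`.
  set E : Multiplicative (ZMod n) → Circle → A := fun g ζ =>
    α ζ (φ (rootProjection n (ζ * (κ g)⁻¹)))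
  have hEsa : ∀ g ζ, IsSelfAdjoint (E g ζ) := fun g ζ => by
    simp only [E, IsSelfAdjoint]
    rw [← map_star, ← map_star, star_rootProjection]
  have hEmul : ∀ g h ζ, E g ζ * E h ζ = if g = h then E g ζ else 0 := fun g h ζ => by
    simp only [E]
    rw [← map_mul, ← map_mul, rootProjection_mul]
    have : (Multiplicative.toAdd g = Multiplicative.toAdd h) ↔ g = h :=
      Multiplicative.toAdd.injective.eq_iff
    simp only [this]
    split_ifs
    · rfl
    · simp
  have hE1 : ∀ g ζ, ‖E g ζ‖ ≤ 1 := fun g ζ =>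
    IsStarProjection.norm_le _ ⟨by simpa [IsIdempotentElem] using hEmul g g ζ, hEsa g ζ⟩
  have hEsum : ∀ ζ, ∑ g, E g ζ = 1 := fun ζ => by
    simp only [E]
    rw [← map_sum, ← map_sum]
    have h1 : ∑ g : Multiplicative (ZMod n), rootProjection n (ζ * (κ g)⁻¹) = 1 :=
      (Equiv.sum_comp Multiplicative.toAdd
        fun g : ZMod n => rootProjection n (ζ * (ZMod.toCircle g)⁻¹)).trans (sum_rootProjection ζ)
    rw [h1, map_one, map_one]
  -- Pulling back by `α_ζ`, the commutator with `a` becomes that of `φ(P)` with `α_{ζ⁻¹}(a)`; hence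
  -- `φ` was taken central for whole orbits.
  have hEcomm : ∀ g ζ, ∀ a ∈ F, ‖E g ζ * a - a * E g ζ‖ ≤ ε / 8 := by
    intro g ζ a ha
    have h1 := norm_map_rootProjection_commutator_le φ (ζ * (κ g)⁻¹)
      (fun i j => hφ i j a ha ζ⁻¹)
    have h2 : α ζ (α ζ⁻¹ a) = a := by
      rw [← StarAlgEquiv.mul_apply, ← map_mul, mul_inv_cancel, map_one, StarAlgEquiv.one_apply]
    rw [← norm_starAlgEquiv_apply (α ζ), map_sub, map_mul, map_mul, h2] at h1
    refine h1.trans (le_of_eq ?_)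
    field_simp
  have hEequi : ∀ g h ζ, α (κ g) (E h ζ) = E (g * h) (κ g * ζ) := by
    intro g h ζ
    simp only [E]
    rw [← StarAlgEquiv.mul_apply, ← map_mul]
    congr 3
    rw [hκ]
    group
    simp [mul_comm, mul_assoc, mul_left_comm]
  have hEcont : Continuous fun ζ => fun g => E g ζ := by
    refine continuous_pi fun g => ?_
    have h1 : ∀ ζ, E g ζ = ∑ i, ∑ j, rootProjection n (ζ * (κ g)⁻¹) i j •
        α ζ (φ (Matrix.single i j 1)) := by
      intro ζ
      simp only [E]
      conv_lhs => rw [rootProjection_eq_sum]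
      simp only [map_sum, map_smul]
    simp only [h1]
    refine continuous_finsetSum _ fun i _ => continuous_finsetSum _ fun j _ => ?_
    exact ((continuous_rootProjection_apply i j).comp (by fun_prop)).smul (hcont _)
  obtain ⟨C, hC, hmod⟩ := exists_modulus hEcont (B := 1)
    (fun ζ => (pi_norm_le_iff_of_nonneg zero_le_one).mpr fun g => hE1 g ζ) (δ := δ₀ / 8)
    (by positivity)
  -- Ensures `16 C / N ≤ δ₀ / 8` for `N = n (m + 1)`, a multiple of `n` so that the grid contains
  -- the `n`-th roots of unity.
  obtain ⟨m, hm⟩ := exists_nat_gt (128 * C / δ₀)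
  set N : ℕ := n * (m + 1)
  have hNpos : 0 < N := Nat.mul_pos (Nat.pos_of_ne_zero (NeZero.ne n)) (Nat.succ_pos m)
  have : NeZero N := ⟨hNpos.ne'⟩
  have hN1 : (1 : ℝ) ≤ N := by exact_mod_cast hNpos
  have hN0 : (0 : ℝ) < N := by linarith
  have hCN : C * (16 / N) ≤ δ₀ / 8 := by
    have h1 : (m : ℝ) ≤ N := by
      have : m ≤ N := (Nat.le_succ m).trans
        (Nat.le_mul_of_pos_left _ (Nat.pos_of_ne_zero (NeZero.ne n)))
      exact_mod_cast this
    have h2 := (div_lt_iff₀ hδ₀).mp (hm.trans_le h1)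
    rw [mul_div_assoc', div_le_iff₀ hN0]
    linarith
  set η : ℝ := min δ₀ ε / (16 * N ^ 3)
  have hη : 0 < η := by positivity
  have hη₁ : 16 * N ^ 3 * η = min δ₀ ε := by simp only [η]; field_simp
  have hηδ : 4 * N ^ 3 * η ≤ δ₀ / 4 := by
    have := min_le_left δ₀ ε
    linarith
  have hηε : 2 * N ^ 2 * η ≤ ε / 8 := by
    have h1 := min_le_right δ₀ ε
    have h2 : (N : ℝ) ^ 2 * η ≤ N ^ 3 * η :=
      mul_le_mul_of_nonneg_right (pow_le_pow_right₀ hN1 (by norm_num)) hη.le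
    linarith
  -- The adjoints of `F` are included because commutators with `b_r^*` are estimated through `a^*`.
  obtain ⟨u, hu, huα, huF⟩ := hα (F ∪ F.image star ∪
    Finset.univ.image fun p : Multiplicative (ZMod n) × ZMod N => E p.1 (ZMod.toCircle p.2)) η hη
  have huE : ∀ g (r : ZMod N), ‖u * E g (ZMod.toCircle r) - E g (ZMod.toCircle r) * u‖ ≤ η :=
    fun g r => (huF _ (Finset.mem_union_right _
      (Finset.mem_image.mpr ⟨(g, r), Finset.mem_univ _, rfl⟩))).le
  set p : Multiplicative (ZMod n) → A := fun g => compress u fun r : ZMod N => E g (ZMod.toCircle r)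
  have hpsum : ∑ g, p g = 1 := by
    simp only [p, sum_compress, hEsum, compress_const_one hu]
  have hpmul : ∀ g h, ‖p g * p h - if g = h then p g else 0‖ ≤ δ₀ := by
    intro g h
    have h1 := norm_compress_mul_sub_le (N := N) hu
      (X := fun r => E g (ZMod.toCircle r)) (Y := fun r => E h (ZMod.toCircle r))
      (fun r => hE1 _ _) (fun r => hE1 _ _) (fun r => hEsa _ _) (fun r => hEsa _ _)
      (δ := δ₀ / 8) (C := C) (η := η) (by positivity) hC (huE g) (huE h)
      (fun r s => (norm_le_pi_norm ((fun g => E g (ZMod.toCircle s)) -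
        fun g => E g (ZMod.toCircle r)) h).trans (hmod _ _))
    have h2 : (compress u fun r : ZMod N => E g (ZMod.toCircle r) * E h (ZMod.toCircle r)) =
        if g = h then p g else 0 := by
      simp only [hEmul]
      split_ifs
      · rfl
      · simp [compress]
    rw [h2] at h1
    refine h1.trans ?_
    linarith
  obtain ⟨e, he, heo, hes, hep⟩ := hproj p (fun g => isSelfAdjoint_compress fun r => hEsa _ _)
    hpsum (fun g => (norm_compress_le hu zero_le_one fun r => hE1 _ _).trans (by norm_num)) hpmul
  refine ⟨e, he, heo, fun g h => ?_, fun g a ha => ?_, hes⟩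
  · obtain ⟨r₀, hr₀⟩ := exists_toCircle_eq (N := N) (dvd_mul_right n (m + 1))
      (Multiplicative.toAdd g)
    have h1 := norm_map_compress_sub_le (N := N) hu ((α (κ g) : A ≃⋆ₐ[ℂ] A) : A →⋆ₐ[ℂ] A)
      (X := fun r => E h (ZMod.toCircle r)) (Y := fun r => E (g * h) (ZMod.toCircle r))
      (fun r => hE1 _ _) r₀ (η := η) (by rw [hr₀]; exact (huα (κ g)).le)
      (fun r => by
        rw [AddChar.map_add_eq_mul, hr₀]
        exact hEequi g h _)
    have h2 : ‖α (κ g) (p h) - p (g * h)‖ ≤ ε / 8 := h1.trans hηε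
    have h3 : ‖α (κ g) (e h - p h)‖ < ε₁ := by
      rw [norm_starAlgEquiv_apply]; exact hep h
    rw [hres]
    have h4 : α (κ g) (e h) - e (g * h) =
        α (κ g) (e h - p h) + (α (κ g) (p h) - p (g * h)) + -(e (g * h) - p (g * h)) := by
      rw [map_sub]; abel
    rw [h4]
    refine norm_add₃_le.trans_lt ?_
    rw [norm_neg]
    have := hep (g * h)
    linarith
  · have h1 := norm_compress_commutator_le (N := N) hu (X := fun r => E g (ZMod.toCircle r))
      (a := a) (η := η) (c := ε / 8) (fun r => hE1 _ _) (by positivity)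
      (huF a (Finset.mem_union_left _ (Finset.mem_union_left _ ha))).le
      (huF _ (Finset.mem_union_left _
        (Finset.mem_union_right _ (Finset.mem_image_of_mem _ ha)))).le
      (fun r => hEcomm g _ a ha)
    change ‖p g * a - a * p g‖ ≤ _ at h1
    have h2 : ‖(e g - p g) * a‖ ≤ ε / 8 := by
      rw [← hε₁M]
      exact (norm_mul_le _ _).trans
        (mul_le_mul (hep g).le (hFM a ha) (norm_nonneg _) hε₁.le)
    have h3 : ‖a * (e g - p g)‖ ≤ ε / 8 := by
      rw [← hε₁M, mul_comm ε₁]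
      exact (norm_mul_le _ _).trans
        (mul_le_mul (hFM a ha) (hep g).le (norm_nonneg _) (by linarith))
    have h4 : e g * a - a * e g = (e g - p g) * a + (p g * a - a * p g) + -(a * (e g - p g)) := by
      simp only [mul_sub, sub_mul]; abel
    rw [h4]
    refine norm_add₃_le.trans_lt ?_
    rw [norm_neg]
    linarith

end Rokhlin

/-! ### Central matrix units and generators -/

section Generators

open Filter Topology

/-- It suffices to find matrix units almost commuting with finite sets of generators. -/
theorem hasCentralMatrixUnits_of_dense {n : ℕ} {A : Type*} [CStarAlgebra A] (G : Set A)
    (hG : Dense (StarAlgebra.adjoin ℂ G : Set A))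
    (h : ∀ (F : Finset A) (ε : ℝ), ↑F ⊆ G → 0 < ε →
      ∃ φ : Matrix (Fin n) (Fin n) ℂ →⋆ₐ[ℂ] A, ∀ i j, ∀ a ∈ F,
        ‖φ (Matrix.single i j 1) * a - a * φ (Matrix.single i j 1)‖ < ε) :
    HasCentralMatrixUnits n A := by
  classical
  have h' : ∀ p : Finset G × ℕ, ∃ φ : Matrix (Fin n) (Fin n) ℂ →⋆ₐ[ℂ] A, ∀ i j, ∀ a ∈ p.1,
      ‖φ (Matrix.single i j 1) * a - a * φ (Matrix.single i j 1)‖ < 1 / ((p.2 : ℝ) + 1) := by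
    intro p
    obtain ⟨φ, hφ⟩ := h (p.1.image Subtype.val) (1 / ((p.2 : ℝ) + 1))
      (by simp) (by positivity)
    exact ⟨φ, fun i j a ha => hφ i j a (Finset.mem_image_of_mem _ ha)⟩
  choose Φ hΦ using h'
  set e : Fin n → Fin n → Finset G × ℕ → A := fun i j p => Φ p (Matrix.single i j 1)
  have he : ∀ i j p, ‖e i j p‖ ≤ 1 := fun i j p => norm_map_single_le _ _ _
  have hes : ∀ i j p, star (e i j p) = e j i p := fun i j p => star_map_single _ _ _
  -- Along the net of pairs (finite set of generators, precision), the elements which asymptotically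
  -- commute with all `e i j` form a unital *-subalgebra, closed because `‖e i j p‖ ≤ 1`.
  set P : A → Prop := fun x => ∀ i j, Tendsto (fun p => e i j p * x - x * e i j p) atTop (𝓝 0)
  have hPG : ∀ x ∈ G, P x := by
    intro x hx i j
    rw [tendsto_zero_iff_norm_tendsto_zero]
    have h1 : Tendsto (fun p : Finset G × ℕ => 1 / ((p.2 : ℝ) + 1)) atTop (𝓝 0) := by
      have := (tendsto_one_div_add_atTop_nhds_zero_nat (𝕜 := ℝ)).comp
        (tendsto_snd (f := (atTop : Filter (Finset G))) (g := (atTop : Filter ℕ)))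
      rwa [prod_atTop_atTop_eq] at this
    refine squeeze_zero' (Eventually.of_forall fun _ => norm_nonneg _) ?_ h1
    filter_upwards [eventually_ge_atTop (({⟨x, hx⟩}, 0) : Finset G × ℕ)] with p hp
    exact (hΦ p i j ⟨x, hx⟩ (hp.1 (Finset.mem_singleton_self _))).le
  have hPadj : ∀ x ∈ StarAlgebra.adjoin ℂ G, P x := by
    intro x hx
    induction hx using StarAlgebra.adjoin_induction with
    | mem x hx => exact hPG x hx
    | algebraMap r =>
      intro i j
      simp [Algebra.algebraMap_eq_smul_one]
    | add x y _ _ hx hy =>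
      intro i j
      have := (hx i j).add (hy i j)
      rw [add_zero] at this
      refine this.congr fun p => ?_
      simp only [mul_add, add_mul]; abel
    | mul x y _ _ hx hy =>
      intro i j
      have h1 := ((hx i j).mul_const y).add ((hy i j).const_mul x)
      rw [zero_mul, mul_zero, add_zero] at h1
      refine h1.congr fun p => ?_
      simp only [mul_sub, sub_mul, mul_assoc]; abel
    | star x _ hx =>
      intro i j
      have h1 := (hx j i).star.neg
      rw [star_zero, neg_zero] at h1
      refine h1.congr fun p => ?_
      rw [star_sub, star_mul, star_mul, hes, neg_sub]
  have hP : ∀ x, P x := by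
    intro x i j
    rw [Metric.tendsto_nhds]
    intro ε hε
    obtain ⟨y, hy, hxy⟩ := Metric.mem_closure_iff.mp (hG x) (ε / 4) (by positivity)
    have h1 := (Metric.tendsto_nhds.mp (hPadj y hy i j)) (ε / 4) (by positivity)
    filter_upwards [h1] with p hp
    rw [dist_zero_right] at hp ⊢
    rw [dist_eq_norm] at hxy
    have h2 : e i j p * x - x * e i j p = (e i j p * y - y * e i j p) +
        (e i j p * (x - y) - (x - y) * e i j p) := by
      simp only [mul_sub, sub_mul]; abel
    have h3 : ‖e i j p * (x - y)‖ ≤ ε / 4 := (norm_mul_le_of_left (he i j p)).trans hxy.le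
    have h4 : ‖(x - y) * e i j p‖ ≤ ε / 4 := (norm_mul_le_of_right (he i j p)).trans hxy.le
    have h5 := norm_sub_le (e i j p * (x - y)) ((x - y) * e i j p)
    have h6 := norm_add_le (e i j p * y - y * e i j p) (e i j p * (x - y) - (x - y) * e i j p)
    rw [h2]
    linarith
  intro F ε hε
  have hev : ∀ᶠ p in atTop, ∀ i j, ∀ a ∈ F, ‖e i j p * a - a * e i j p‖ < ε := by
    rw [eventually_all]; intro i
    rw [eventually_all]; intro j
    rw [eventually_all_finset]; intro a _
    have := (Metric.tendsto_nhds.mp (hP a i j)) ε hε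
    simpa [dist_zero_right] using this
  obtain ⟨p, hp⟩ := hev.exists
  exact ⟨Φ p, hp⟩

/-- Elements of a subset generate a dense subalgebra of the closure of the algebra it generates. -/
theorem dense_adjoin_preimage_val {B : Type*} [CStarAlgebra B] (G : Set B)
    (S : StarSubalgebra ℂ B) (hS : S = (StarAlgebra.adjoin ℂ G).topologicalClosure) :
    Dense (StarAlgebra.adjoin ℂ ((↑) ⁻¹' G : Set S) : Set S) := by
  intro x
  have hi : Topology.IsInducing ((↑) : S → B) := Topology.IsInducing.subtypeVal
  rw [hi.closure_eq_preimage_closure_image]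
  have h1 : ((↑) : S → B) '' (StarAlgebra.adjoin ℂ ((↑) ⁻¹' G : Set S) : Set S) =
      (StarAlgebra.adjoin ℂ G : Set B) := by
    have h2 := StarAlgHom.map_adjoin (S.subtype) ((↑) ⁻¹' G : Set S)
    have h3 : S.subtype '' ((↑) ⁻¹' G : Set S) = G := by
      change ((↑) : S → B) '' ((↑) ⁻¹' G : Set S) = G
      refine Set.image_preimage_eq_of_subset ?_
      rw [Subtype.range_coe]
      exact hS ▸ (StarAlgebra.subset_adjoin ℂ G).trans (StarSubalgebra.le_topologicalClosure _)
    rw [h3] at h2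
    rw [← h2]
    rfl
  rw [h1, Set.mem_preimage]
  have hx : (x : B) ∈ (StarAlgebra.adjoin ℂ G).topologicalClosure := hS ▸ x.2
  exact hx

/-- Central matrix units relative to the generators of `D` give central matrix units of any
`A` which absorbs `D`. -/
theorem hasCentralMatrixUnits_of_tensoriallyAbsorbs {n : ℕ} {A D : Type*} [CStarAlgebra A]
    [CStarAlgebra D] (hD : HasCentralMatrixUnits n D) (h : TensoriallyAbsorbs A D) :
    HasCentralMatrixUnits n A := by
  classical
  obtain ⟨C, _, i, j, hij, ⟨e⟩⟩ := h
  have hC : HasCentralMatrixUnits n C := by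
    refine hasCentralMatrixUnits_of_dense (Set.range i ∪ Set.range j) ?_ ?_
    · refine hij.denseRange.mono ?_
      rintro _ ⟨t, rfl⟩
      induction t using TensorProduct.induction_on with
      | zero => rw [map_zero]; exact zero_mem _
      | tmul a d =>
        rw [Algebra.TensorProduct.lift_tmul]
        exact mul_mem (StarAlgebra.subset_adjoin ℂ _ (Or.inl ⟨a, rfl⟩))
          (StarAlgebra.subset_adjoin ℂ _ (Or.inr ⟨d, rfl⟩))
      | add x y hx hy => rw [map_add]; exact add_mem hx hy
    · intro F ε hF hε
      have hpre : ∀ x : C, ∃ d : D, x ∈ Set.range j → j d = x := by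
        intro x
        by_cases hx : x ∈ Set.range j
        · obtain ⟨d, hd⟩ := hx
          exact ⟨d, fun _ => hd⟩
        · exact ⟨0, fun h => absurd h hx⟩
      choose f hf using hpre
      obtain ⟨φ, hφ⟩ := hD (F.image f) ε hε
      -- The image of `φ` under `j` commutes exactly with the range of `i`, so only generators
      -- coming from `D` need an estimate.
      refine ⟨j.comp φ, fun k l a ha => ?_⟩
      simp only [StarAlgHom.comp_apply]
      rcases hF ha with ⟨b, rfl⟩ | hj
      · rw [(hij.commute b _).eq, sub_self, norm_zero]
        exact hε
      · have h1 := hφ k l (f a) (Finset.mem_image_of_mem _ ha)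
        refine lt_of_le_of_lt ?_ h1
        have h2 := NonUnitalStarAlgHom.norm_apply_le j (φ (Matrix.single k l 1) * f a -
          f a * φ (Matrix.single k l 1))
        rwa [map_sub, map_mul, map_mul, hf a hj] at h2
  intro F ε hε
  obtain ⟨φ, hφ⟩ := hC (F.image e.symm) ε hε
  refine ⟨(e : C →⋆ₐ[ℂ] A).comp φ, fun k l a ha => ?_⟩
  have h1 := hφ k l (e.symm a) (Finset.mem_image_of_mem _ ha)
  refine lt_of_le_of_lt ?_ h1
  have h2 := NonUnitalStarAlgHom.norm_apply_le (e : C →⋆ₐ[ℂ] A) (φ (Matrix.single k l 1) *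
    e.symm a - e.symm a * φ (Matrix.single k l 1))
  rw [map_sub, map_mul, map_mul] at h2
  have h3 : (e : C →⋆ₐ[ℂ] A) (e.symm a) = a := e.apply_symm_apply a
  rw [h3] at h2
  exact h2

end Generators

/-! ### Cuntz families -/

/-- A finite family of isometries whose range projections add up to one. -/
structure IsCuntzFamily {B ι : Type*} [CStarAlgebra B] [Fintype ι] [DecidableEq ι]
    (s : ι → B) : Prop where
  star_mul_eq : ∀ i j, star (s i) * s j = if i = j then 1 else 0
  sum_mul_star : ∑ i, s i * star (s i) = 1

namespace IsCuntzFamily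

variable {B ι : Type*} [CStarAlgebra B] [Fintype ι] [DecidableEq ι] {s : ι → B}

/-- The unital copy of the matrix algebra spanned by the `s_i s_j^*`. -/
noncomputable def matrixHom (h : IsCuntzFamily s) : Matrix ι ι ℂ →⋆ₐ[ℂ] B where
  toFun M := ∑ i, ∑ j, M i j • (s i * star (s j))
  map_one' := by simp [Matrix.one_apply, h.sum_mul_star]
  map_zero' := by simp
  map_add' M M' := by simp [add_smul, Finset.sum_add_distrib]
  map_mul' M M' := by
    have key : ∀ i j k l, (M i j • (s i * star (s j))) * (M' k l • (s k * star (s l))) =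
        if j = k then (M i j * M' k l) • (s i * star (s l)) else 0 := by
      intro i j k l
      rw [smul_mul_smul_comm, mul_assoc, ← mul_assoc (star (s j)), h.star_mul_eq]
      split_ifs <;> simp
    simp only [Finset.sum_mul_sum, key, Matrix.mul_apply, Finset.sum_smul]
    refine Finset.sum_congr rfl fun i _ => ?_
    rw [Finset.sum_comm]
    refine Finset.sum_congr rfl fun k _ => ?_
    rw [Finset.sum_comm]
    simp
  commutes' r := by
    have : (1 : B) = ∑ i, s i * star (s i) := h.sum_mul_star.symm
    simp [Matrix.algebraMap_matrix_apply, Algebra.algebraMap_eq_smul_one, ite_smul, this,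
      Finset.smul_sum]
  map_star' M := by
    rw [star_sum, Finset.sum_comm]
    simp [star_smul]

theorem matrixHom_apply (h : IsCuntzFamily s) (M : Matrix ι ι ℂ) :
    h.matrixHom M = ∑ i, ∑ j, M i j • (s i * star (s j)) := rfl

theorem matrixHom_single (h : IsCuntzFamily s) (i j : ι) :
    h.matrixHom (Matrix.single i j 1) = s i * star (s j) := by
  rw [matrixHom_apply, Finset.sum_eq_single i, Finset.sum_eq_single j]
  · simp
  · intro k _ hk; simp [hk.symm]
  · simp
  · intro k _ hk
    exact Finset.sum_eq_zero fun l _ => by simp [hk.symm]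
  · simp

/-- The canonical endomorphism `x ↦ ∑ s_i x s_i^*`. -/
noncomputable def endo (h : IsCuntzFamily s) : B →⋆ₐ[ℂ] B where
  toFun x := ∑ i, s i * x * star (s i)
  map_one' := by simp [h.sum_mul_star]
  map_zero' := by simp
  map_add' x y := by simp [mul_add, add_mul, Finset.sum_add_distrib]
  map_mul' x y := by
    have key : ∀ i j, s i * x * star (s i) * (s j * y * star (s j)) =
        if i = j then s i * (x * y) * star (s i) else 0 := by
      intro i j
      have : s i * x * star (s i) * (s j * y * star (s j)) =
        s i * x * (star (s i) * s j) * y * star (s j) := by simp only [mul_assoc]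
      rw [this, h.star_mul_eq]
      split_ifs with hij
      · subst hij; simp [mul_assoc]
      · simp
    simp [Finset.sum_mul_sum, key]
  commutes' r := by
    simp [Algebra.algebraMap_eq_smul_one, ← Finset.smul_sum, h.sum_mul_star]
  map_star' x := by simp [star_sum, mul_assoc]

theorem endo_apply (h : IsCuntzFamily s) (x : B) : h.endo x = ∑ i, s i * x * star (s i) := rfl

/-- This intertwining turns `[x, s_i]` into `(x - λ(x)) s_i`: approximate centrality becomes
approximate invariance under the endomorphism. -/
theorem endo_mul (h : IsCuntzFamily s) (x : B) (i : ι) : h.endo x * s i = s i * x := by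
  simp [endo_apply, Finset.sum_mul, mul_assoc, h.star_mul_eq]

theorem star_mul_endo (h : IsCuntzFamily s) (x : B) (i : ι) :
    star (s i) * h.endo x = x * star (s i) := by
  have := congrArg star (h.endo_mul (star x) i)
  rwa [star_mul, star_mul, ← map_star, star_star] at this

/-- By the intertwining relations both products equal `s_i x s_j^*`. -/
theorem commute_endo (h : IsCuntzFamily s) (x : B) (i j : ι) :
    Commute (s i * star (s j)) (h.endo x) := by
  rw [Commute, SemiconjBy, mul_assoc, h.star_mul_endo, ← mul_assoc, ← mul_assoc, h.endo_mul]

end IsCuntzFamily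

/-! ### The block isometries -/

section Block

theorem ellTwo_ext {T T' : EllTwo →L[ℂ] EllTwo} (h : ∀ k, T (stdBasis k) = T' (stdBasis k)) :
    T = T' :=
  ContinuousLinearMap.ext_on
    (Submodule.dense_iff_topologicalClosure_eq_top.mpr stdBasis.dense_span)
    (by rintro _ ⟨k, rfl⟩; exact h k)

theorem norm_blockIsometry_apply (n : ℕ) (i : Fin n) (x : EllTwo) : ‖blockIsometry n i x‖ = ‖x‖ :=
  (orthonormal_stdBasis_mul_add i).orthogonalFamily.linearIsometry.norm_map x

theorem star_blockIsometry_mul (n : ℕ) (i j : Fin n) :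
    star (blockIsometry n i) * blockIsometry n j = if i = j then 1 else 0 := by
  split_ifs with h
  · subst h
    exact (ContinuousLinearMap.norm_map_iff_adjoint_comp_self _).mp (norm_blockIsometry_apply n i)
  · refine ellTwo_ext fun k => ext_inner_left ℂ fun x => ?_
    rw [mul_apply_eq_comp, ContinuousLinearMap.star_eq_adjoint,
      ContinuousLinearMap.adjoint_inner_right, blockIsometry_apply_stdBasis]
    have h0 : (innerSL ℂ (stdBasis (n * k + j))).comp (blockIsometry n i) = 0 := by
      refine ContinuousLinearMap.ext_on
        (Submodule.dense_iff_topologicalClosure_eq_top.mpr stdBasis.dense_span) ?_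
      rintro _ ⟨l, rfl⟩
      rw [ContinuousLinearMap.comp_apply, blockIsometry_apply_stdBasis, innerSL_apply_apply]
      refine stdBasis.orthonormal.2 fun hkl => h ?_
      have hn : 0 < n := lt_of_le_of_lt (Nat.zero_le _) i.isLt
      have := congrArg (· % n) hkl
      simp only [Nat.mul_add_mod, Nat.mod_eq_of_lt i.2, Nat.mod_eq_of_lt j.2] at this
      exact Fin.ext this.symm
    have h1 := DFunLike.congr_fun h0 x
    rw [ContinuousLinearMap.comp_apply, innerSL_apply_apply] at h1
    rw [← inner_conj_symm, h1]
    simp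

theorem isCuntzFamily_blockIsometry (n : ℕ) [NeZero n] : IsCuntzFamily (blockIsometry n) where
  star_mul_eq := star_blockIsometry_mul n
  sum_mul_star := by
    refine ellTwo_ext fun k => ?_
    have hn : 0 < n := Nat.pos_of_ne_zero (NeZero.ne n)
    set j : Fin n := ⟨k % n, Nat.mod_lt k hn⟩
    have hk : stdBasis k = blockIsometry n j (stdBasis (k / n)) := by
      rw [blockIsometry_apply_stdBasis]
      congr 1
      exact (Nat.div_add_mod k n).symm
    rw [hk, ← mul_apply_eq_comp, ← mul_apply_eq_comp, one_mul,
      Finset.sum_mul]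
    congr 1
    rw [Finset.sum_eq_single j]
    · rw [mul_assoc, star_blockIsometry_mul, if_pos rfl, mul_one]
    · intro i _ hi
      rw [mul_assoc, star_blockIsometry_mul, if_neg hi, mul_zero]
    · simp

/-- Mixed-radix expansion `m(kl + j) + i = (km)l + (mj + i)`; the inner index `j` is therefore the
leading digit. -/
theorem blockIsometry_mul_blockIsometry (m k : ℕ) (i : Fin m) (j : Fin k) :
    blockIsometry m i * blockIsometry k j = blockIsometry (k * m) (finProdFinEquiv (j, i)) := by
  refine ellTwo_ext fun l => ?_
  rw [mul_apply_eq_comp, blockIsometry_apply_stdBasis, blockIsometry_apply_stdBasis,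
    blockIsometry_apply_stdBasis]
  congr 1
  simp only [finProdFinEquiv_apply_val]
  ring

theorem endo_blockIsometry_mul (m k : ℕ) [NeZero m] [NeZero k] [NeZero (k * m)]
    (x : EllTwo →L[ℂ] EllTwo) : (isCuntzFamily_blockIsometry (k * m)).endo x =
      (isCuntzFamily_blockIsometry m).endo ((isCuntzFamily_blockIsometry k).endo x) := by
  simp only [IsCuntzFamily.endo_apply]
  rw [← Equiv.sum_comp finProdFinEquiv, Fintype.sum_prod_type_right]
  refine Finset.sum_congr rfl fun i _ => ?_
  rw [Finset.mul_sum, Finset.sum_mul]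
  refine Finset.sum_congr rfl fun j _ => ?_
  rw [← blockIsometry_mul_blockIsometry, star_mul]
  simp only [mul_assoc]

/-- For `N = k m` the endomorphism factors as that of `m` after that of `k`, so its range lies in
the range of the former. -/
theorem commute_endo_blockIsometry {m N : ℕ} [NeZero N] (h : m ∣ N) (x : EllTwo →L[ℂ] EllTwo)
    (a b : Fin m) :
    Commute (blockIsometry m a * star (blockIsometry m b))
      ((isCuntzFamily_blockIsometry N).endo x) := by
  obtain ⟨k, rfl⟩ := exists_eq_mul_left_of_dvd h
  have hkm : k * m ≠ 0 := NeZero.ne _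
  have : NeZero m := ⟨(mul_ne_zero_iff.mp hkm).2⟩
  have : NeZero k := ⟨(mul_ne_zero_iff.mp hkm).1⟩
  rw [endo_blockIsometry_mul]
  exact (isCuntzFamily_blockIsometry m).commute_endo _ a b

/-- Conjugating a matrix unit of `M_n` by `V_{N,r}` gives a matrix unit of `M_{nN}`. -/
theorem endo_matrixHom_mem_universalUHF (n N : ℕ) [NeZero n] [NeZero N]
    (M : Matrix (Fin n) (Fin n) ℂ) :
    (isCuntzFamily_blockIsometry N).endo ((isCuntzFamily_blockIsometry n).matrixHom M) ∈
      universalUHF := by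
  rw [IsCuntzFamily.matrixHom_apply, map_sum]
  refine sum_mem fun i _ => ?_
  rw [map_sum]
  refine sum_mem fun j _ => ?_
  rw [map_smul]
  refine SMulMemClass.smul_mem _ ?_
  rw [IsCuntzFamily.endo_apply]
  refine sum_mem fun r _ => ?_
  have : blockIsometry N r * (blockIsometry n i * star (blockIsometry n j)) *
      star (blockIsometry N r) = blockIsometry (n * N) (finProdFinEquiv (i, r)) *
        star (blockIsometry (n * N) (finProdFinEquiv (j, r))) := by
    rw [← blockIsometry_mul_blockIsometry, ← blockIsometry_mul_blockIsometry, star_mul]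
    simp only [mul_assoc]
  rw [this]
  exact StarSubalgebra.le_topologicalClosure _
    (StarAlgebra.subset_adjoin ℂ _ ⟨n * N, _, _, rfl⟩)

/-- A finite set of generators involves finitely many sizes `m`. With `N` their product, the
endomorphism of `N` carries `M_n` to a copy inside `𝒬` that commutes exactly with all of them. -/
theorem hasCentralMatrixUnits_universalUHF (n : ℕ) [NeZero n] :
    HasCentralMatrixUnits n universalUHF := by
  classical
  refine hasCentralMatrixUnits_of_dense _ (dense_adjoin_preimage_val _ _ rfl) ?_
  intro F ε hF hε
  have hF' : ∀ x : universalUHF, ∃ m : ℕ, m ≠ 0 ∧ (x ∈ F → ∃ i j : Fin m,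
      (x : EllTwo →L[ℂ] EllTwo) = blockIsometry m i * star (blockIsometry m j)) := by
    intro x
    by_cases hx : x ∈ F
    · obtain ⟨m, i, j, h⟩ := hF hx
      exact ⟨m, (lt_of_le_of_lt (Nat.zero_le _) i.isLt).ne', fun _ => ⟨i, j, h⟩⟩
    · exact ⟨1, one_ne_zero, fun h => absurd h hx⟩
  choose f hf0 hf using hF'
  set N := ∏ x ∈ F, f x
  have : NeZero N := ⟨Finset.prod_ne_zero_iff.mpr fun x _ => hf0 x⟩
  refine ⟨StarAlgHom.codRestrict
    ((isCuntzFamily_blockIsometry N).endo.comp (isCuntzFamily_blockIsometry n).matrixHom)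
    universalUHF (endo_matrixHom_mem_universalUHF n N), fun k l a ha => ?_⟩
  obtain ⟨i, j, hij⟩ := hf a ha
  have hc := commute_endo_blockIsometry (Finset.dvd_prod_of_mem f ha)
    ((isCuntzFamily_blockIsometry n).matrixHom (Matrix.single k l 1)) i j
  have h0 : ∀ y : universalUHF, (y : EllTwo →L[ℂ] EllTwo) =
      (isCuntzFamily_blockIsometry N).endo
        ((isCuntzFamily_blockIsometry n).matrixHom (Matrix.single k l 1)) →
      y * a - a * y = 0 := by
    intro y hy
    apply Subtype.ext
    change (y : EllTwo →L[ℂ] EllTwo) * a - a * y = 0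
    rw [hy, hij, hc.eq, sub_self]
  rw [h0 _ rfl, norm_zero]
  exact hε

end Block

/-! ### Paths from unitaries with finite spectrum to the identity -/

section Path

variable {B : Type*} [CStarAlgebra B]

theorem finite_spectrum_of_isIntegral {x : B} (hx : IsIntegral ℂ x) : (spectrum ℂ x).Finite := by
  obtain ⟨p, hp, hpx⟩ := hx
  have h1 : (Polynomial.aeval x) p = 0 := hpx
  refine (p.rootSet_finite ℂ).subset fun z hz => ?_
  rw [Polynomial.mem_rootSet]
  refine ⟨hp.ne_zero, ?_⟩
  have h2 := spectrum.subset_polynomial_aeval x p ⟨z, hz, rfl⟩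
  rw [h1] at h2
  have : Nontrivial B := by
    by_contra hB
    rw [not_nontrivial_iff_subsingleton] at hB
    rw [spectrum.of_subsingleton] at hz
    exact hz
  rw [spectrum.zero_eq, Set.mem_singleton_iff] at h2
  simpa using h2

/-- A unitary with finite spectrum is joined to `1` by `m` short steps. -/
theorem exists_unitary_steps {U : B} (hU : U ∈ unitary B) (hfin : (spectrum ℂ U).Finite) (m : ℕ)
    (hm : m ≠ 0) :
    ∃ y : ℕ → B, y 0 = U ∧ y m = 1 ∧ (∀ j, y j ∈ unitary B) ∧
      (∀ j, ‖y j - y (j + 1)‖ ≤ Real.pi / m) ∧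
      ∀ j x, Commute U x → Commute (star U) x → Commute (y j) x := by
  have hm0 : (m : ℝ) ≠ 0 := by exact_mod_cast hm
  have : IsStarNormal U := isStarNormal_of_mem_unitary hU
  have hc : ∀ f : ℂ → ℂ, ContinuousOn f (spectrum ℂ U) := fun f => hfin.continuousOn f
  -- Shrinks the argument linearly to zero. Finiteness of the spectrum makes `arg` continuous there,
  -- despite its branch cut.
  set f : ℕ → ℂ → ℂ := fun j z => Complex.exp (Complex.I * ((1 - j / m : ℝ) * Complex.arg z : ℝ))
  refine ⟨fun j => cfc (f j) U, ?_, ?_, fun j => ?_, fun j => ?_, fun j x h₁ h₂ => h₁.cfc h₂ _⟩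
  · conv_rhs => rw [← cfc_id ℂ U]
    refine cfc_congr fun z hz => ?_
    have h1 : ‖z‖ = 1 := by
      have := spectrum.subset_circle_of_unitary hU hz
      simpa using this
    have h2 := Complex.norm_mul_exp_arg_mul_I z
    rw [h1] at h2
    simp only [f, id]
    rw [mul_comm]
    simpa using h2
  · conv_rhs => rw [← cfc_const_one ℂ U]
    refine cfc_congr fun z _ => ?_
    simp only [f]
    rw [div_self hm0]
    simp
  · rw [cfc_unitary_iff (f j) U (hf := hc _)]
    intro z _
    simp only [f]
    rw [Complex.star_def, Complex.conj_mul', mul_comm Complex.I, Complex.norm_exp_ofReal_mul_I]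
    simp
  · rw [← cfc_sub _ _ _ (hc _) (hc _)]
    refine norm_cfc_le (by positivity) fun z _ => ?_
    have e : f j z = f (j + 1) z * Complex.exp (Complex.I * (Complex.arg z / m : ℝ)) := by
      simp only [f]
      rw [← Complex.exp_add, ← mul_add, ← Complex.ofReal_add]
      congr 3
      push_cast
      field_simp
      ring
    rw [e]
    have e2 : f (j + 1) z * Complex.exp (Complex.I * (Complex.arg z / m : ℝ)) - f (j + 1) z =
        f (j + 1) z * (Complex.exp (Complex.I * (Complex.arg z / m : ℝ)) - 1) := by ring
    have e3 : ‖f (j + 1) z‖ = 1 := by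
      simp only [f]
      rw [mul_comm Complex.I, Complex.norm_exp_ofReal_mul_I]
    rw [e2, norm_mul, e3, one_mul]
    refine Real.norm_exp_I_mul_ofReal_sub_one_le.trans ?_
    rw [Real.norm_eq_abs, abs_div, Nat.abs_cast]
    gcongr
    exact Complex.abs_arg_le_pi z

end Path

/-! ### Anticommuting self-adjoint unitaries -/

section Clifford

variable {B : Type*} [CStarAlgebra B]

/-- The Jordan–Wigner sequence of an endomorphism `σ` and two elements `X`, `Z`. -/
def jordanWigner (σ : B →⋆ₐ[ℂ] B) (X Z : B) : ℕ → B
  | 0 => X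
  | j + 1 => Z * σ (jordanWigner σ X Z j)

variable {σ : B →⋆ₐ[ℂ] B} {X Z : B}

/-- A single term satisfies `σ(c_j) = Z c_{j+1}`, not a pure shift; in a product of two the factors
`Z` cancel. -/
theorem map_jordanWigner_mul (hZ : Z * Z = 1) (hσ : ∀ y, Commute Z (σ y)) (i j : ℕ) :
    σ (jordanWigner σ X Z i * jordanWigner σ X Z j) =
      jordanWigner σ X Z (i + 1) * jordanWigner σ X Z (j + 1) := by
  simp only [jordanWigner]
  rw [map_mul, (hσ _).eq, mul_assoc, ← mul_assoc Z, hZ, one_mul]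

theorem jordanWigner_mul_self (hX : X * X = 1) (hZ : Z * Z = 1) (hσ : ∀ y, Commute Z (σ y))
    (j : ℕ) : jordanWigner σ X Z j * jordanWigner σ X Z j = 1 := by
  induction j with
  | zero => exact hX
  | succ j ih => rw [← map_jordanWigner_mul hZ hσ, ih, map_one]

theorem isSelfAdjoint_jordanWigner (hX : IsSelfAdjoint X) (hZ : IsSelfAdjoint Z)
    (hσ : ∀ y, Commute Z (σ y)) (j : ℕ) : IsSelfAdjoint (jordanWigner σ X Z j) := by
  induction j with
  | zero => exact hX
  | succ j ih =>
    simp only [jordanWigner, IsSelfAdjoint]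
    rw [star_mul, hZ.star_eq, ← map_star, ih.star_eq, (hσ _).eq]

/-- For `i = 0` the sign comes from `X` meeting the leading `Z` of `c_j`; other pairs are shifts of
such a pair. -/
theorem jordanWigner_anticomm (hZ : Z * Z = 1) (hXZ : X * Z = -(Z * X))
    (hσX : ∀ y, Commute X (σ y)) (hσZ : ∀ y, Commute Z (σ y)) {i j : ℕ} (hij : i < j) :
    jordanWigner σ X Z i * jordanWigner σ X Z j = -(jordanWigner σ X Z j * jordanWigner σ X Z i) := by
  induction i generalizing j with
  | zero =>
    obtain ⟨j, rfl⟩ := Nat.exists_eq_succ_of_ne_zero hij.ne'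
    simp only [jordanWigner]
    rw [← mul_assoc, hXZ, neg_mul, mul_assoc, (hσX _).eq, ← mul_assoc]
  | succ i ih =>
    obtain ⟨j, rfl⟩ := Nat.exists_eq_succ_of_ne_zero (Nat.ne_zero_of_lt hij)
    rw [Nat.succ_eq_add_one, ← map_jordanWigner_mul hZ hσZ, ← map_jordanWigner_mul hZ hσZ,
      ih (Nat.lt_of_succ_lt_succ hij), map_neg]

/-- The anticommutator of two linear combinations of anticommuting self-adjoint unitaries. -/
theorem sum_smul_anticomm {c : ℕ → B} (hc : ∀ i, c i * c i = 1)
    (ha : ∀ i j, i < j → c i * c j = -(c j * c i)) (a b : ℕ → ℂ) (K : ℕ) :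
    (∑ i ∈ Finset.range K, a i • c i) * (∑ j ∈ Finset.range K, b j • c j) +
      (∑ j ∈ Finset.range K, b j • c j) * (∑ i ∈ Finset.range K, a i • c i) =
      (2 * ∑ i ∈ Finset.range K, a i * b i) • 1 := by
  have h1 : ∀ i j, c i * c j + c j * c i = if i = j then (2 : ℂ) • (1 : B) else 0 := by
    intro i j
    split_ifs with h
    · subst h; rw [hc, two_smul]
    · rcases lt_or_gt_of_ne h with h | h
      · rw [ha i j h]; simp
      · rw [ha j i h]; simp
  rw [Finset.sum_mul_sum, Finset.sum_mul_sum, Finset.sum_comm (s := Finset.range K)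
    (t := Finset.range K) (f := fun j i => (b j • c j) * (a i • c i)), ← Finset.sum_add_distrib]
  have h2 : ∀ i ∈ Finset.range K, (∑ j ∈ Finset.range K, a i • c i * b j • c j) +
      (∑ j ∈ Finset.range K, b j • c j * a i • c i) = (2 * (a i * b i)) • (1 : B) := by
    intro i hi
    rw [← Finset.sum_add_distrib]
    have h3 : ∀ j ∈ Finset.range K, a i • c i * b j • c j + b j • c j * a i • c i =
        if i = j then (2 * (a i * b i)) • (1 : B) else 0 := by
      intro j _
      rw [smul_mul_smul_comm, smul_mul_smul_comm, mul_comm (b j), ← smul_add, h1]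
      split_ifs with h
      · subst h; rw [smul_smul, mul_comm]
      · rw [smul_zero]
    rw [Finset.sum_congr rfl h3]
    simp [Finset.mem_range.mp hi]
  rw [Finset.sum_congr rfl h2, ← Finset.sum_smul, Finset.mul_sum]

/-- A projection which is almost flipped by `σ`. -/
theorem exists_flipped_projection [Nontrivial B] (hX : X * X = 1) (hZ : Z * Z = 1)
    (hXs : IsSelfAdjoint X)
    (hZs : IsSelfAdjoint Z) (hXZ : X * Z = -(Z * X)) (hσX : ∀ y, Commute X (σ y))
    (hσZ : ∀ y, Commute Z (σ y)) {ε : ℝ} (hε : 0 < ε) :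
    ∃ (f : B) (K : ℕ), IsStarProjection f ∧ ‖σ f - (1 - f)‖ < ε ∧
      ∀ y, (∀ j ≤ K, Commute (jordanWigner σ X Z j) y) → Commute f y := by
  obtain ⟨k, hk⟩ := exists_nat_gt (2 / ε)
  have hk0 : (0 : ℝ) < k := lt_trans (by positivity) hk
  -- `K = (2k)²` is a perfect square, so the norm of `x` is `2k`, and it is even, so the alternating
  -- signs sum to zero and return to `+1` at index `K`.
  set K : ℕ := 2 * (2 * k ^ 2) with hKdef
  have hKr : (K : ℝ) = (2 * k) ^ 2 := by simp only [K]; push_cast; ring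
  have hK0 : (K : ℝ) ≠ 0 := by rw [hKr]; positivity
  have hKc : (K : ℂ) ≠ 0 := by exact_mod_cast hK0
  set c := jordanWigner σ X Z
  have hc : ∀ i, c i * c i = 1 := jordanWigner_mul_self hX hZ hσZ
  have hcs : ∀ i, IsSelfAdjoint (c i) := isSelfAdjoint_jordanWigner hXs hZs hσZ
  have hca : ∀ i j, i < j → c i * c j = -(c j * c i) := fun i j =>
    jordanWigner_anticomm hZ hXZ hσX hσZ
  have hcσ : ∀ i j, σ (c i * c j) = c (i + 1) * c (j + 1) := map_jordanWigner_mul hZ hσZ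
  have hcn : ∀ i, ‖c i‖ = 1 := by
    intro i
    have h1 := CStarRing.norm_star_mul_self (x := c i)
    rw [(hcs i).star_eq, hc, norm_one] at h1
    nlinarith [norm_nonneg (c i)]
  -- The coefficient vectors of `x` and `y` are orthogonal, so `x` and `y` anticommute and `(i/K) x
  -- y` is a self-adjoint unitary. The index shift nearly fixes `x` and nearly negates `y`.
  set x : B := ∑ i ∈ Finset.range K, (1 : ℂ) • c i with hx
  set y : B := ∑ i ∈ Finset.range K, ((-1 : ℂ) ^ i) • c i with hy
  have hsgn : ∑ i ∈ Finset.range K, (-1 : ℂ) ^ i = 0 := by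
    rw [neg_one_geom_sum, if_pos (even_two_mul _)]
  have hxx : x * x = (K : ℂ) • 1 := by
    have h1 := sum_smul_anticomm hc hca (fun _ => 1) (fun _ => 1) K
    rw [← two_smul ℂ (_ * _), mul_smul] at h1
    have h2 := smul_right_injective B (two_ne_zero (α := ℂ)) h1
    simpa [hx] using h2
  have hyy : y * y = (K : ℂ) • 1 := by
    have h1 := sum_smul_anticomm hc hca (fun i => (-1) ^ i) (fun i => (-1) ^ i) K
    rw [← two_smul ℂ (_ * _), mul_smul] at h1
    have h2 := smul_right_injective B (two_ne_zero (α := ℂ)) h1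
    simpa [hy, ← mul_pow] using h2
  have hxy : y * x = -(x * y) := by
    have h1 := sum_smul_anticomm hc hca (fun _ => 1) (fun i => (-1) ^ i) K
    simp only [one_mul, hsgn, mul_zero, zero_smul] at h1
    rw [add_comm] at h1
    exact eq_neg_of_add_eq_zero_left h1
  have hxs : IsSelfAdjoint x := isSelfAdjoint_sum _ fun i _ => by rw [one_smul]; exact hcs i
  have hys : IsSelfAdjoint y := isSelfAdjoint_sum _ fun i _ =>
    IsSelfAdjoint.smul (by simp [IsSelfAdjoint]) (hcs i)
  have hnorm : ∀ w : B, IsSelfAdjoint w → w * w = (K : ℂ) • 1 → ‖w‖ = 2 * k := by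
    intro w hw hww
    have h1 := CStarRing.norm_star_mul_self (x := w)
    rw [hw.star_eq, hww, norm_smul, norm_one, mul_one, Complex.norm_natCast, hKr, ← sq] at h1
    exact ((sq_eq_sq₀ (by positivity) (norm_nonneg _)).mp h1).symm
  have hxn := hnorm x hxs hxx
  have hyn := hnorm y hys hyy
  set V : B := (Complex.I / K) • (x * y) with hV
  have hVV : V * V = 1 := by
    have h1 : x * y * (x * y) = -((K : ℂ) * K) • (1 : B) := by
      calc x * y * (x * y) = x * (y * x) * y := by simp only [mul_assoc]
        _ = -(x * x * (y * y)) := by rw [hxy]; simp only [mul_neg, neg_mul, mul_assoc]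
        _ = _ := by rw [hxx, hyy, smul_mul_smul_comm, mul_one, neg_smul]
    rw [hV, smul_mul_smul_comm, h1, smul_smul]
    have : Complex.I / K * (Complex.I / K) * -((K : ℂ) * K) = 1 := by
      field_simp
      simp
    rw [this, one_smul]
  have hVs : IsSelfAdjoint V := by
    rw [IsSelfAdjoint, hV, star_smul, star_mul, hxs.star_eq, hys.star_eq, hxy]
    have h1 : star (Complex.I / K) = -(Complex.I / K) := by
      simp [neg_div]
    rw [h1, neg_smul, smul_neg, neg_neg]
  set d : B := c K - c 0
  have hd : ‖d‖ ≤ 2 := by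
    refine (norm_sub_le _ _).trans ?_
    rw [hcn, hcn]; norm_num
  -- Shifting changes each sum only by the boundary term `d`, of norm at most 2 against `‖x‖ = ‖y‖ =
  -- 2k`. Only the product `x y`, of even degree, is shifted by `σ`.
  have hσxy : σ (x * y) = (x + d) * -(y + d) := by
    have e1 : ∑ i ∈ Finset.range K, (1 : ℂ) • c (i + 1) = x + d := by
      have h1 := Finset.sum_range_succ (fun i => (1 : ℂ) • c i) K
      have h2 := Finset.sum_range_succ' (fun i => (1 : ℂ) • c i) K
      rw [h1] at h2
      rw [one_smul, one_smul] at h2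
      simp only [d]
      rw [← add_sub_assoc, h2, add_sub_cancel_right]
    have e2 : ∑ i ∈ Finset.range K, ((-1 : ℂ) ^ i) • c (i + 1) = -(y + d) := by
      have h1 := Finset.sum_range_succ (fun i => ((-1 : ℂ) ^ i) • c i) K
      have h2 := Finset.sum_range_succ' (fun i => ((-1 : ℂ) ^ i) • c i) K
      rw [h1, Even.neg_one_pow (even_two_mul _), pow_zero, one_smul, one_smul] at h2
      simp only [pow_succ, mul_neg, mul_one, neg_smul, Finset.sum_neg_distrib] at h2
      simp only [d]
      rw [← add_sub_assoc, h2, add_sub_cancel_right, neg_neg]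
    rw [← e1, ← e2, hx, hy, Finset.sum_mul_sum, Finset.sum_mul_sum, map_sum]
    refine Finset.sum_congr rfl fun i _ => ?_
    rw [map_sum]
    refine Finset.sum_congr rfl fun j _ => ?_
    rw [smul_mul_smul_comm, smul_mul_smul_comm, map_smul, hcσ]
  refine ⟨(2 : ℂ)⁻¹ • (1 + V), K, ⟨?_, ?_⟩, ?_, fun w hw => ?_⟩
  · rw [IsIdempotentElem, smul_mul_smul_comm, mul_add, add_mul, add_mul, hVV, one_mul, one_mul,
      mul_one, add_comm V 1, ← two_smul ℂ (1 + V), smul_smul]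
    norm_num
  · exact IsSelfAdjoint.smul (by simp [IsSelfAdjoint]) ((IsSelfAdjoint.one B).add hVs)
  · have e : σ ((2 : ℂ)⁻¹ • (1 + V)) - (1 - (2 : ℂ)⁻¹ • (1 + V)) =
        (-((2 : ℂ)⁻¹ * (Complex.I / K))) • (x * d + d * y + d * d) := by
      rw [map_smul, map_add, map_one, hV, map_smul, hσxy]
      have e1 : (1 : B) = (2 : ℂ)⁻¹ • 1 + (2 : ℂ)⁻¹ • 1 := by
        rw [← add_smul]; norm_num
      conv_lhs => enter [2, 1]; rw [e1]
      simp only [smul_add, smul_smul, mul_add, add_mul, mul_neg, neg_smul, smul_neg, neg_add]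
      abel
    rw [e, norm_smul, norm_neg, norm_mul, norm_div, Complex.norm_I, norm_inv, Complex.norm_natCast,
      hKr]
    have h1 : ‖x * d + d * y + d * d‖ ≤ 8 * k + 4 := by
      refine norm_add₃_le.trans ?_
      have g1 : ‖x * d‖ ≤ 2 * k * 2 := (norm_mul_le _ _).trans
        (mul_le_mul hxn.le hd (norm_nonneg _) (by positivity))
      have g2 : ‖d * y‖ ≤ 2 * (2 * k) := (norm_mul_le _ _).trans
        (mul_le_mul hd hyn.le (norm_nonneg _) (by positivity))
      have g3 : ‖d * d‖ ≤ 2 * 2 := (norm_mul_le _ _).trans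
        (mul_le_mul hd hd (norm_nonneg _) (by positivity))
      linarith
    have hk1 : (1 : ℝ) ≤ k := by
      have : 0 < k := by exact_mod_cast hk0
      exact_mod_cast this
    have h2 : ‖(2 : ℂ)‖⁻¹ * (1 / (2 * k) ^ 2) * ‖x * d + d * y + d * d‖ ≤
        ‖(2 : ℂ)‖⁻¹ * (1 / (2 * k) ^ 2) * (12 * k) :=
      mul_le_mul_of_nonneg_left (by linarith) (by positivity)
    refine h2.trans_lt ?_
    have h3 : ‖(2 : ℂ)‖⁻¹ * (1 / (2 * (k : ℝ)) ^ 2) * (12 * k) = 3 / 2 / k := by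
      rw [Complex.norm_ofNat]
      field_simp
      norm_num
    rw [h3, div_lt_iff₀ hk0]
    rw [div_lt_iff₀ hε] at hk
    linarith
  · have h1 : ∀ a : ℕ → ℂ, Commute (∑ i ∈ Finset.range K, a i • c i) w := fun a =>
      Commute.sum_left _ _ _ fun i hi => (hw i (Finset.mem_range.mp hi).le).smul_left _
    exact ((Commute.one_left w).add_left (((h1 _).mul_left (h1 _)).smul_left _)).smul_left _

end Clifford

/-! ### Words in a Cuntz family -/

section Words

namespace IsCuntzFamily

variable {B ι : Type*} [CStarAlgebra B] {s : ι → B}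

variable (s) in
/-- The product of generators along a word. -/
def word (μ : List ι) : B := (μ.map s).prod

theorem word_nil : word s ([] : List ι) = 1 := rfl

theorem word_cons (i : ι) (μ : List ι) : word s (i :: μ) = s i * word s μ := by simp [word]

theorem word_append (μ ν : List ι) : word s (μ ++ ν) = word s μ * word s ν := by simp [word]

variable (s) in
/-- The span of the products `s_μ s_ν^*` for words of length `K`. -/
noncomputable def level (K : ℕ) : Submodule ℂ B :=
  Submodule.span ℂ {x | ∃ μ ν : List ι, μ.length = K ∧ ν.length = K ∧
    x = word s μ * star (word s ν)}

theorem word_mul_star_word_mem_level {K : ℕ} {μ ν : List ι} (hμ : μ.length = K)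
    (hν : ν.length = K) : word s μ * star (word s ν) ∈ level s K :=
  Submodule.subset_span ⟨μ, ν, hμ, hν, rfl⟩

theorem fg_level [Finite ι] (K : ℕ) : (level s K).FG := by
  refine Submodule.fg_span ?_
  have h1 := List.finite_length_eq ι K
  refine ((h1.prod h1).image fun p : List ι × List ι => word s p.1 * star (word s p.2)).subset ?_
  rintro x ⟨μ, ν, hμ, hν, rfl⟩
  exact ⟨(μ, ν), ⟨hμ, hν⟩, rfl⟩

variable [Fintype ι] [DecidableEq ι]

theorem endo_pow_add_apply (h : IsCuntzFamily s) (K L : ℕ) (x : B) :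
    (h.endo ^ (K + L)) x = (h.endo ^ K) ((h.endo ^ L) x) := by
  rw [pow_add]; rfl

theorem endo_pow_succ_apply (h : IsCuntzFamily s) (K : ℕ) (x : B) :
    (h.endo ^ (K + 1)) x = h.endo ((h.endo ^ K) x) := by
  rw [pow_succ']; rfl

theorem endo_pow_succ_apply' (h : IsCuntzFamily s) (K : ℕ) (x : B) :
    (h.endo ^ (K + 1)) x = (h.endo ^ K) (h.endo x) := by
  rw [pow_succ]; rfl

theorem endo_pow_mul_word (h : IsCuntzFamily s) (μ : List ι) (K : ℕ) (y : B) :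
    (h.endo ^ (K + μ.length)) y * word s μ = word s μ * (h.endo ^ K) y := by
  induction μ with
  | nil => simp [word_nil]
  | cons i μ ih =>
    rw [word_cons, List.length_cons, ← add_assoc, endo_pow_succ_apply, ← mul_assoc, h.endo_mul,
      mul_assoc, ih, mul_assoc]

theorem star_word_mul_endo_pow (h : IsCuntzFamily s) (μ : List ι) (K : ℕ) (y : B) :
    star (word s μ) * (h.endo ^ (K + μ.length)) y = (h.endo ^ K) y * star (word s μ) := by
  have := congrArg star (h.endo_pow_mul_word μ K (star y))
  rwa [star_mul, star_mul, ← map_star, ← map_star, star_star] at this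

theorem star_word_mul_word (h : IsCuntzFamily s) {μ ν : List ι} (hl : μ.length = ν.length) :
    star (word s μ) * word s ν = if μ = ν then 1 else 0 := by
  induction μ generalizing ν with
  | nil =>
    obtain rfl := List.length_eq_zero_iff.mp hl.symm
    simp [word_nil]
  | cons i μ ih =>
    cases ν with
    | nil => simp at hl
    | cons j ν =>
      rw [word_cons, word_cons, star_mul, mul_assoc, ← mul_assoc (star (s i)), h.star_mul_eq]
      by_cases hij : i = j
      · subst hij
        rw [if_pos rfl, one_mul, ih (by simpa using hl)]
        simp
      · simp [hij]

/-- Insert `1 = ∑ s_i s_i^*` between `s_μ` and `s_ν^*`. -/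
theorem level_mono (h : IsCuntzFamily s) : Monotone (level s) := by
  refine monotone_nat_of_le_succ fun K => ?_
  rw [level, Submodule.span_le]
  rintro x ⟨μ, ν, hμ, hν, rfl⟩
  have e : word s μ * star (word s ν) = ∑ i, word s (μ ++ [i]) * star (word s (ν ++ [i])) := by
    simp only [word_append, star_mul, word_cons, word_nil, mul_one]
    have : ∀ i, word s μ * s i * (star (s i) * star (word s ν)) =
        word s μ * (s i * star (s i)) * star (word s ν) := fun i => by simp only [mul_assoc]
    simp only [this]
    rw [← Finset.sum_mul, ← Finset.mul_sum, h.sum_mul_star, mul_one]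
  rw [e]
  exact sum_mem fun i _ => word_mul_star_word_mem_level (by simp [hμ]) (by simp [hν])

theorem one_mem_level (h : IsCuntzFamily s) (K : ℕ) : (1 : B) ∈ level s K := by
  refine h.level_mono (Nat.zero_le K) ?_
  have := word_mul_star_word_mem_level (s := s) (K := 0) (μ := []) (ν := []) rfl rfl
  simpa [word_nil] using this

theorem mul_mem_level (h : IsCuntzFamily s) {K : ℕ} {x y : B} (hx : x ∈ level s K)
    (hy : y ∈ level s K) : x * y ∈ level s K := by
  induction hx using Submodule.span_induction with
  | zero => rw [zero_mul]; exact zero_mem _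
  | add a b _ _ ha hb => rw [add_mul]; exact add_mem ha hb
  | smul c a _ ha => rw [smul_mul_assoc]; exact Submodule.smul_mem _ _ ha
  | mem a ha =>
    obtain ⟨μ, ν, hμ, hν, rfl⟩ := ha
    induction hy using Submodule.span_induction with
    | zero => rw [mul_zero]; exact zero_mem _
    | add a b _ _ ha hb => rw [mul_add]; exact add_mem ha hb
    | smul c a _ ha => rw [mul_smul_comm]; exact Submodule.smul_mem _ _ ha
    | mem b hb =>
      obtain ⟨μ', ν', hμ', hν', rfl⟩ := hb
      rw [mul_assoc, ← mul_assoc (star _), h.star_word_mul_word (hν.trans hμ'.symm)]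
      split_ifs
      · rw [one_mul]; exact word_mul_star_word_mem_level hμ hν'
      · simp

/-- A level is a finite-dimensional unital subalgebra. -/
theorem isIntegral_of_mem_level (h : IsCuntzFamily s) {K : ℕ} {x : B} (hx : x ∈ level s K) :
    IsIntegral ℂ x := by
  set S : Subalgebra ℂ B := (level s K).toSubalgebra (h.one_mem_level K)
    fun x y hx hy => h.mul_mem_level hx hy
  exact IsIntegral.of_mem_of_fg S (by simpa [S] using fg_level K) x hx

theorem endo_pow_word_mem (h : IsCuntzFamily s) (x : B) (m : ℕ) :
    (h.endo ^ m) x ∈ Submodule.span ℂ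
      {z | ∃ ρ : List ι, ρ.length = m ∧ z = word s ρ * x * star (word s ρ)} := by
  induction m with
  | zero => exact Submodule.subset_span ⟨[], rfl, by rw [word_nil, star_one, one_mul, mul_one]; rfl⟩
  | succ m ih =>
    rw [endo_pow_succ_apply]
    generalize (h.endo ^ m) x = z at ih
    induction ih using Submodule.span_induction with
    | zero => rw [map_zero]; exact zero_mem _
    | add a b _ _ ha hb => rw [map_add]; exact add_mem ha hb
    | smul c a _ ha => rw [map_smul]; exact Submodule.smul_mem _ _ ha
    | mem a ha =>
      obtain ⟨ρ, hρ, rfl⟩ := ha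
      rw [endo_apply]
      refine sum_mem fun i _ => Submodule.subset_span ⟨i :: ρ, by simp [hρ], ?_⟩
      simp only [word_cons, star_mul, mul_assoc]

/-- The element is a combination of terms `s_{ρμ} s_{μρ}^*`, whose two words have the same length.
-/
theorem endo_pow_word_mul_star_mem_level (h : IsCuntzFamily s) (μ : List ι) (m : ℕ) :
    (h.endo ^ m) (word s μ) * star (word s μ) ∈ level s (m + μ.length) := by
  have h1 := h.endo_pow_word_mem (word s μ) m
  generalize (h.endo ^ m) (word s μ) = z at h1
  induction h1 using Submodule.span_induction with
  | zero => rw [zero_mul]; exact zero_mem _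
  | add a b _ _ ha hb => rw [add_mul]; exact add_mem ha hb
  | smul c a _ ha => rw [smul_mul_assoc]; exact Submodule.smul_mem _ _ ha
  | mem a ha =>
    obtain ⟨ρ, hρ, rfl⟩ := ha
    have : word s ρ * word s μ * star (word s ρ) * star (word s μ) =
        word s (ρ ++ μ) * star (word s (μ ++ ρ)) := by
      simp only [word_append, star_mul, mul_assoc]
    rw [this]
    exact word_mul_star_word_mem_level (by simp [hρ]) (by simp [hρ, add_comm])

end IsCuntzFamily

end Words

/-! ### Cuntz families with two generators -/

section CuntzPair

namespace IsCuntzFamily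

variable {B : Type*} [CStarAlgebra B] {s : Fin 2 → B}

/-- Two Cuntz isometries contain Cuntz families of every positive size. -/
theorem exists_words (h : IsCuntzFamily s) (n : ℕ) :
    ∃ μ : Fin (n + 1) → List (Fin 2), IsCuntzFamily fun k => word s (μ k) := by
  induction n with
  | zero =>
    refine ⟨fun _ => [], ⟨fun i j => ?_, ?_⟩⟩
    · rw [Fin.fin_one_eq_zero i, Fin.fin_one_eq_zero j]
      simp [word_nil]
    · simp [word_nil]
  | succ n ih =>
    obtain ⟨μ, hμ⟩ := ih
    -- Keep the branch `0` and refine the branch `1`: the words are `0, 10, 110, …`, ending with a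
    -- word of ones only.
    refine ⟨Fin.cons [0] fun k => 1 :: μ k, ⟨fun i j => ?_, ?_⟩⟩
    · refine Fin.cases ?_ (fun i => ?_) i <;> refine Fin.cases ?_ (fun j => ?_) j
      · simp [word_cons, word_nil, h.star_mul_eq]
      · simp only [Fin.cons_zero, Fin.cons_succ, word_cons, word_nil, mul_one]
        rw [← mul_assoc, h.star_mul_eq, if_neg (by decide), zero_mul,
          if_neg (Fin.succ_ne_zero j).symm]
      · simp only [Fin.cons_zero, Fin.cons_succ, word_cons, word_nil, mul_one, star_mul]
        rw [mul_assoc, h.star_mul_eq, if_neg (by decide), mul_zero, if_neg (Fin.succ_ne_zero i)]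
      · simp only [Fin.cons_succ, word_cons, star_mul]
        rw [mul_assoc, ← mul_assoc (star (s 1)), h.star_mul_eq, if_pos rfl, one_mul,
          hμ.star_mul_eq]
        simp
    · rw [Fin.sum_univ_succ]
      simp only [Fin.cons_zero, Fin.cons_succ, word_cons, word_nil, mul_one, star_mul]
      have : ∀ k, s 1 * word s (μ k) * (star (word s (μ k)) * star (s 1)) =
          s 1 * (word s (μ k) * star (word s (μ k))) * star (s 1) := fun k => by
        simp only [mul_assoc]
      simp only [this]
      rw [← Finset.sum_mul, ← Finset.mul_sum, hμ.sum_mul_star, mul_one, ← h.sum_mul_star,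
        Fin.sum_univ_two]

variable [Nontrivial B]

/-- A projection which is almost flipped by the `q`-th power of the canonical endomorphism. -/
theorem exists_endo_flipped (h : IsCuntzFamily s) {q : ℕ} (hq : q ≠ 0) {ε : ℝ} (hε : 0 < ε) :
    ∃ (f : B) (K : ℕ), IsStarProjection f ∧ ‖(h.endo ^ q) f - (1 - f)‖ < ε ∧
      ∀ y, Commute f ((h.endo ^ K) y) := by
  -- The Pauli matrices of the copy of `M_2`, which commutes with the range of the endomorphism.
  set X : B := s 0 * star (s 1) + s 1 * star (s 0)
  set Z : B := s 0 * star (s 0) - s 1 * star (s 1)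
  have hs := h.sum_mul_star
  rw [Fin.sum_univ_two] at hs
  have hm : ∀ i j k l : Fin 2, s i * star (s j) * (s k * star (s l)) =
      if j = k then s i * star (s l) else 0 := by
    intro i j k l
    rw [mul_assoc, ← mul_assoc (star (s j)), h.star_mul_eq]
    split_ifs <;> simp
  have hX : X * X = 1 := by
    simp only [X, mul_add, add_mul, hm]
    simpa [add_comm] using hs
  have hZ : Z * Z = 1 := by
    simp only [Z, mul_sub, sub_mul, hm]
    simpa using hs
  have hXZ : X * Z = -(Z * X) := by
    simp only [X, Z, mul_sub, sub_mul, mul_add, add_mul, hm]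
    simp [sub_eq_add_neg]
  have hXs : IsSelfAdjoint X := by simp [X, IsSelfAdjoint, add_comm]
  have hZs : IsSelfAdjoint Z := by simp [Z, IsSelfAdjoint]
  have hσX1 : ∀ y, Commute X (h.endo y) := fun y =>
    (h.commute_endo y 0 1).add_left (h.commute_endo y 1 0)
  have hσZ1 : ∀ y, Commute Z (h.endo y) := fun y =>
    (h.commute_endo y 0 0).sub_left (h.commute_endo y 1 1)
  obtain ⟨q, rfl⟩ := Nat.exists_eq_succ_of_ne_zero hq
  have hσX : ∀ y, Commute X ((h.endo ^ (q + 1)) y) := fun y => by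
    rw [endo_pow_succ_apply]; exact hσX1 _
  have hσZ : ∀ y, Commute Z ((h.endo ^ (q + 1)) y) := fun y => by
    rw [endo_pow_succ_apply]; exact hσZ1 _
  obtain ⟨f, K, hf, hf1, hf2⟩ := exists_flipped_projection hX hZ hXs hZs hXZ hσX hσZ hε
  refine ⟨f, (q + 1) * (K + 1), hf, hf1, fun y => hf2 _ fun j hj => ?_⟩
  -- `c_j` is built from images of `X` and `Z` under powers up to the `j`-th of `λ^{q+1}`, so it
  -- commutes with the range of one further power.
  have key : ∀ j y, Commute (jordanWigner (h.endo ^ (q + 1)) X Z j)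
      ((h.endo ^ ((q + 1) * (j + 1))) y) := by
    intro j
    induction j with
    | zero => intro y; rw [zero_add, mul_one]; exact hσX y
    | succ j ih =>
      intro y
      have e : (q + 1) * (j + 1 + 1) = (q + 1) + (q + 1) * (j + 1) := by ring
      rw [e, endo_pow_add_apply]
      exact (hσZ _).mul_left ((ih y).map (h.endo ^ (q + 1)))
  have e : (q + 1) * (K + 1) = (q + 1) * (j + 1) + (q + 1) * (K - j) := by
    rw [← mul_add]
    congr 1
    omega
  rw [e, endo_pow_add_apply]
  exact key j _

/-- Rokhlin towers of height `2^k` for the canonical endomorphism. -/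
theorem exists_tower (h : IsCuntzFamily s) (k : ℕ) {ε : ℝ} (hε : 0 < ε) :
    ∃ (e : ℕ → B) (K : ℕ), (∀ j, IsStarProjection (e j)) ∧
      (∀ i < 2 ^ k, ∀ j < 2 ^ k, i ≠ j → e i * e j = 0) ∧ ∑ j ∈ Finset.range (2 ^ k), e j = 1 ∧
      e (2 ^ k) = e 0 ∧ (∀ j < 2 ^ k, ‖h.endo (e j) - e (j + 1)‖ < ε) ∧
      ∀ j y, Commute (e j) ((h.endo ^ K) y) := by
  induction k generalizing ε with
  | zero =>
    refine ⟨fun _ => 1, 0, fun _ => IsStarProjection.one B, fun i hi j hj hij => ?_, by simp, rfl,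
      fun j _ => by simpa using hε, fun j y => Commute.one_left _⟩
    omega
  | succ k ih =>
    obtain ⟨e, K, he, heo, hes, hem, hesh, hec⟩ := ih (ε := ε / 2) (by positivity)
    set m := 2 ^ k with hmdef
    have hm : 0 < m := by positivity
    have hm2 : 2 ^ (k + 1) = m + m := by rw [pow_succ]; omega
    obtain ⟨f, K', hf, hf1, hf2⟩ := h.exists_endo_flipped hm.ne' (ε := ε / 2) (by positivity)
    -- Applying `λ^K` first makes `g` commute with the old tower. Since `λ^m` almost flips `f`, each
    -- level `e_j` splits into `e_j g_j` and `e_j (1 - g_j)`, and one turn around the old tower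
    -- leads from the first half to the second.
    set g : ℕ → B := fun j => (h.endo ^ (K + j)) f with hg
    have hgp : ∀ j, IsStarProjection (g j) := fun j => hf.map (h.endo ^ (K + j))
    have hge : ∀ i j, Commute (e i) (g j) := fun i j => by
      simp only [g]; rw [endo_pow_add_apply]; exact hec i _
    have hgs : ∀ j, h.endo (g j) = g (j + 1) := fun j => by
      simp only [g]; rw [← endo_pow_succ_apply]; rfl
    have hgm : ‖g m - (1 - g 0)‖ < ε / 2 := by
      have e1 : g m - (1 - g 0) = (h.endo ^ K) ((h.endo ^ m) f - (1 - f)) := by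
        simp only [g]
        rw [endo_pow_add_apply, map_sub, map_sub, map_one, add_zero]
      rw [e1]
      exact (NonUnitalStarAlgHom.norm_apply_le _ _).trans_lt hf1
    have hgc : ∀ j ≤ m, ∀ y, Commute (g j) ((h.endo ^ (K + K' + m)) y) := by
      intro j hj y
      have e1 : K + K' + m = (K + j) + (K' + (m - j)) := by omega
      simp only [g]
      rw [e1, h.endo_pow_add_apply (K + j) (K' + (m - j)), h.endo_pow_add_apply K']
      exact (hf2 _).map (h.endo ^ (K + j))
    have hec' : ∀ j y, Commute (e j) ((h.endo ^ (K + K' + m)) y) := by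
      intro j y
      rw [add_assoc, endo_pow_add_apply]
      exact hec j _
    -- The last branch is the wrap-around value: it makes `e'` at `2m` equal to `e'` at `0`.
    set e' : ℕ → B := fun j => if j < m then e j * g j else
      if j < m + m then e (j - m) * (1 - g (j - m)) else e 0 * g 0 with he'
    have v1 : ∀ j < m, e' j = e j * g j := fun j hj => by simp only [he', if_pos hj]
    have v2 : ∀ j < m, e' (m + j) = e j * (1 - g j) := fun j hj => by
      simp only [he']
      rw [if_neg (by omega), if_pos (by omega), Nat.add_sub_cancel_left]
    have v3 : e' (m + m) = e 0 * g 0 := by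
      simp only [he']
      rw [if_neg (by omega), if_neg (by omega)]
    have hen : ∀ j, ‖e j‖ ≤ 1 := fun j => (he j).norm_le
    have hstep : ∀ j < m, ∀ p p' : B, IsStarProjection p' → ‖h.endo p - p'‖ < ε / 2 →
        ‖h.endo (e j * p) - e (j + 1) * p'‖ < ε := by
      intro j hj p p' hp' hpp
      have e1 : h.endo (e j * p) - e (j + 1) * p' =
          h.endo (e j) * (h.endo p - p') + (h.endo (e j) - e (j + 1)) * p' := by
        rw [map_mul]; simp only [mul_sub, sub_mul]; abel
      rw [e1]
      refine (norm_add_le _ _).trans_lt ?_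
      have g1 : ‖h.endo (e j) * (h.endo p - p')‖ ≤ ‖h.endo p - p'‖ :=
        norm_mul_le_of_left ((NonUnitalStarAlgHom.norm_apply_le h.endo _).trans (hen j))
      have g2 : ‖(h.endo (e j) - e (j + 1)) * p'‖ ≤ ‖h.endo (e j) - e (j + 1)‖ :=
        norm_mul_le_of_right hp'.norm_le
      have := hesh j hj
      linarith
    have hε2 : 0 < ε / 2 := by positivity
    have hform : ∀ j < m + m, ∃ r < m, (j = r ∧ e' j = e r * g r) ∨
        (j = m + r ∧ e' j = e r * (1 - g r)) := by
      intro j hj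
      by_cases hjm : j < m
      · exact ⟨j, hjm, Or.inl ⟨rfl, v1 j hjm⟩⟩
      · refine ⟨j - m, by omega, Or.inr ⟨by omega, ?_⟩⟩
        have := v2 (j - m) (by omega)
        rwa [Nat.add_sub_cancel' (by omega)] at this
    have horth : ∀ r r' : ℕ, ∀ p p' : B, Commute (e r') p → e r * e r' = 0 →
        e r * p * (e r' * p') = 0 := by
      intro r r' p p' hc h0
      rw [mul_assoc, ← mul_assoc p, ← hc.eq, mul_assoc (e r'), ← mul_assoc (e r), h0, zero_mul]
    have horth' : ∀ r : ℕ, ∀ p p' : B, Commute (e r) p → p * p' = 0 →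
        e r * p * (e r * p') = 0 := by
      intro r p p' hc h0
      rw [mul_assoc, ← mul_assoc p, ← hc.eq, mul_assoc (e r), h0, mul_zero, mul_zero]
    have hge' : ∀ i j, Commute (e i) (1 - g j) := fun i j =>
      (Commute.one_right _).sub_right (hge i j)
    refine ⟨e', K + K' + m, fun j => ?_, fun i hi j hj hij => ?_, ?_, ?_, fun j hj => ?_,
      fun j y => ?_⟩
    · simp only [he']
      split_ifs
      · exact (he j).mul (hgp j) (hge j j)
      · exact (he _).mul (hgp _).one_sub (hge' _ _)
      · exact (he 0).mul (hgp 0) (hge 0 0)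
    · rw [hm2] at hi hj
      obtain ⟨r, hr, hr'⟩ := hform i hi
      obtain ⟨t, ht, ht'⟩ := hform j hj
      by_cases hrt : r = t
      · subst hrt
        rcases hr' with ⟨rfl, h1⟩ | ⟨rfl, h1⟩ <;> rcases ht' with ⟨h2, h3⟩ | ⟨h2, h3⟩
        · omega
        · rw [h1, h3]; exact horth' _ _ _ (hge _ _) (hgp _).mul_one_sub_self
        · rw [h1, h3]; exact horth' _ _ _ (hge' _ _) (hgp _).one_sub_mul_self
        · omega
      · have h0 := heo r hr t ht hrt
        rcases hr' with ⟨-, h1⟩ | ⟨-, h1⟩ <;> rcases ht' with ⟨-, h3⟩ | ⟨-, h3⟩ <;> rw [h1, h3]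
        · exact horth _ _ _ _ (hge _ _) h0
        · exact horth _ _ _ _ (hge _ _) h0
        · exact horth _ _ _ _ (hge' _ _) h0
        · exact horth _ _ _ _ (hge' _ _) h0
    · rw [hm2, Finset.sum_range_add, ← Finset.sum_add_distrib, ← hes]
      refine Finset.sum_congr rfl fun j hj => ?_
      rw [v1 j (Finset.mem_range.mp hj), v2 j (Finset.mem_range.mp hj), ← mul_add,
        add_sub_cancel, mul_one]
    · rw [hm2, v3, v1 0 hm]
    · rw [hm2] at hj
      obtain ⟨r, hr, ⟨rfl, h1⟩ | ⟨rfl, h1⟩⟩ := hform j hj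
      · rw [h1]
        by_cases hjm : j + 1 < m
        · rw [v1 _ hjm]
          exact hstep j hr _ _ (hgp _) (by rw [hgs, sub_self, norm_zero]; exact hε2)
        · have hjm' : j + 1 = m := by omega
          have h2 := v2 0 hm
          rw [add_zero] at h2
          rw [hjm', h2, ← hem, ← hjm']
          refine hstep j hr _ _ (hgp _).one_sub ?_
          rw [hgs, hjm']
          exact hgm
      · rw [h1, add_assoc]
        by_cases hjm : r + 1 < m
        · rw [v2 _ hjm]
          refine hstep r hr _ _ (hgp _).one_sub ?_
          rw [map_sub, map_one, hgs, sub_self, norm_zero]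
          exact hε2
        · have hjm' : r + 1 = m := by omega
          rw [hjm', v3, ← hem, ← hjm']
          refine hstep r hr _ _ (hgp _) ?_
          have e1 : 1 - g m - g 0 = -(g m - (1 - g 0)) := by abel
          rw [map_sub, map_one, hgs, hjm', e1, norm_neg]
          exact hgm
    · simp only [he']
      split_ifs with h1 h2
      · exact (hec' _ _).mul_left (hgc j h1.le y)
      · exact (hec' _ _).mul_left ((Commute.one_left _).sub_left (hgc _ (by omega) y))
      · exact (hec' _ _).mul_left (hgc 0 hm.le y)

end IsCuntzFamily

end CuntzPair

/-! ### Central matrix units in `𝒪₂` -/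

section Coboundary

namespace IsCuntzFamily

variable {B : Type*} [CStarAlgebra B] {s : Fin 2 → B} {n : ℕ}

/-- The unitary carrying the Cuntz family `t` to its image under the `j`-th power of the canonical
endomorphism. -/
noncomputable def transport (h : IsCuntzFamily s) (t : Fin n → B) (j : ℕ) : B :=
  ∑ k, (h.endo ^ j) (t k) * star (t k)

theorem transport_mul (h : IsCuntzFamily s) {t : Fin n → B} (ht : IsCuntzFamily t) (j : ℕ)
    (k : Fin n) : h.transport t j * t k = (h.endo ^ j) (t k) := by
  simp [transport, Finset.sum_mul, mul_assoc, ht.star_mul_eq]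

theorem transport_zero (h : IsCuntzFamily s) {t : Fin n → B} (ht : IsCuntzFamily t) :
    h.transport t 0 = 1 :=
  ht.sum_mul_star

theorem transport_mem_unitary (h : IsCuntzFamily s) {t : Fin n → B} (ht : IsCuntzFamily t)
    (j : ℕ) : h.transport t j ∈ unitary B := by
  have hs : star (h.transport t j) = ∑ k, t k * (h.endo ^ j) (star (t k)) := by
    simp [transport, star_sum, map_star]
  rw [Unitary.mem_iff]
  constructor
  · have : ∀ k, star (h.transport t j) * ((h.endo ^ j) (t k) * star (t k)) =
        t k * star (t k) := by
      intro k
      rw [hs, Finset.sum_mul, Finset.sum_eq_single k]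
      · rw [mul_assoc, ← mul_assoc ((h.endo ^ j) _), ← map_mul, ht.star_mul_eq, if_pos rfl,
          map_one, one_mul]
      · intro l _ hl
        rw [mul_assoc, ← mul_assoc ((h.endo ^ j) _), ← map_mul, ht.star_mul_eq, if_neg hl,
          map_zero, zero_mul, mul_zero]
      · simp
    change star (h.transport t j) * ∑ k, (h.endo ^ j) (t k) * star (t k) = 1
    rw [Finset.mul_sum]
    simp only [this, ht.sum_mul_star]
  · rw [hs, Finset.mul_sum]
    simp only [← mul_assoc, h.transport_mul ht, ← map_mul]
    rw [← map_sum, ht.sum_mul_star, map_one]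

/-- The cocycle identity: `λ(t_k^*) W_1 = t_k^*`, so `W_1` absorbs the shift of the second factor.
-/
theorem endo_transport_mul (h : IsCuntzFamily s) {t : Fin n → B} (ht : IsCuntzFamily t)
    (j : ℕ) : h.endo (h.transport t j) * h.transport t 1 = h.transport t (j + 1) := by
  change h.endo (∑ k, (h.endo ^ j) (t k) * star (t k)) * h.transport t 1 =
    ∑ k, (h.endo ^ (j + 1)) (t k) * star (t k)
  rw [map_sum, Finset.sum_mul]
  refine Finset.sum_congr rfl fun k _ => ?_
  have e : h.endo (star (t k)) * h.transport t 1 = star (t k) := by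
    have h1 : star (h.transport t 1) * h.endo (t k) = t k := by
      have h2 := h.transport_mul ht 1 k
      rw [pow_one] at h2
      rw [← h2, ← mul_assoc, Unitary.star_mul_self_of_mem (h.transport_mem_unitary ht 1), one_mul]
    have h3 := congrArg star h1
    rwa [star_mul, star_star, ← map_star] at h3
  rw [map_mul, mul_assoc, e, endo_pow_succ_apply]

theorem commute_of_le (h : IsCuntzFamily s) {x : B} {K M : ℕ}
    (hx : ∀ y, Commute x ((h.endo ^ K) y)) (hKM : K ≤ M) (y : B) :
    Commute x ((h.endo ^ M) y) := by
  obtain ⟨r, rfl⟩ := Nat.exists_eq_add_of_le hKM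
  rw [endo_pow_add_apply]
  exact hx _

theorem commute_endo_pow (h : IsCuntzFamily s) {x : B} {K : ℕ}
    (hx : ∀ y, Commute x ((h.endo ^ K) y)) (j : ℕ) (y : B) :
    Commute ((h.endo ^ j) x) ((h.endo ^ (j + K)) y) := by
  rw [endo_pow_add_apply]
  exact (hx y).map (h.endo ^ j)

/-- Passing `t_k^*` lowers the exponent of `λ` by the length of the word, and passing `λ^j(t_k)`
restores it; the total length leaves enough room for every `k`. -/
theorem commute_transport (h : IsCuntzFamily s) (μ : Fin n → List (Fin 2)) (j : ℕ) (y : B) :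
    Commute (h.transport (fun k => word s (μ k)) j)
      ((h.endo ^ (j + ∑ k, (μ k).length)) y) := by
  refine Commute.sum_left _ _ _ fun k _ => ?_
  obtain ⟨r, hr⟩ := Nat.exists_eq_add_of_le
    (Finset.single_le_sum (fun k _ => Nat.zero_le (μ k).length) (Finset.mem_univ k))
  have e1 : j + ∑ k, (μ k).length = j + r + (μ k).length := by rw [hr]; ring
  have e2 : j + r + (μ k).length = j + (r + (μ k).length) := by ring
  rw [e1, Commute, SemiconjBy, mul_assoc, h.star_word_mul_endo_pow, ← mul_assoc, ← mul_assoc]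
  congr 1
  rw [e2, endo_pow_add_apply, endo_pow_add_apply, ← map_mul, ← map_mul, h.endo_pow_mul_word]

/-- Gives the transport unitary finite spectrum, which is what permits the path to `1`. -/
theorem isIntegral_transport (h : IsCuntzFamily s) (μ : Fin n → List (Fin 2)) (j : ℕ) :
    IsIntegral ℂ (h.transport (fun k => word s (μ k)) j) := by
  refine h.isIntegral_of_mem_level (K := j + ∑ k, (μ k).length) (sum_mem fun k _ => ?_)
  refine h.level_mono ?_ (h.endo_pow_word_mul_star_mem_level (μ k) j)
  have := Finset.single_le_sum (fun k _ => Nat.zero_le (μ k).length) (Finset.mem_univ k)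
  omega

variable [Nontrivial B]

/-- The cocycle of a Cuntz family of words is almost a coboundary. -/
theorem exists_unitary_endo_mul_transport (h : IsCuntzFamily s) (μ : Fin n → List (Fin 2))
    (ht : IsCuntzFamily fun k => word s (μ k)) {ε : ℝ} (hε : 0 < ε) :
    ∃ v ∈ unitary B, ‖h.endo v * h.transport (fun k => word s (μ k)) 1 - v‖ ≤ ε := by
  set t : Fin n → B := fun k => word s (μ k)
  set L := ∑ k, (μ k).length
  -- Height `2^k > 4π/ε` keeps twice the step `π/m` of the path below `ε/2`.
  obtain ⟨k, hk⟩ := pow_unbounded_of_one_lt (4 * Real.pi / ε) (one_lt_two (α := ℝ))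
  set m : ℕ := 2 ^ k with hmdef
  have hm : 0 < m := by positivity
  have hm0 : (0 : ℝ) < m := by exact_mod_cast hm
  have hπ : 2 * (Real.pi / m) ≤ ε / 2 := by
    have h1 : 4 * Real.pi / ε < m := by simpa [m] using hk
    rw [div_lt_iff₀ hε] at h1
    rw [mul_div_assoc', div_le_iff₀ hm0]
    linarith
  obtain ⟨e, -, he, heo, hes, hem, hesh, -⟩ := h.exists_tower k (ε := ε / (2 * m)) (by positivity)
  rw [← hmdef] at heo hes hem hesh
  set W := h.transport t
  have hWu : ∀ j, W j ∈ unitary B := h.transport_mem_unitary ht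
  obtain ⟨y, hy0, hym, hyu, hystep, hyc⟩ := exists_unitary_steps (hWu m)
    (finite_spectrum_of_isIntegral (h.isIntegral_transport μ m)) m hm.ne'
  have hWc : ∀ j z, Commute (W j) ((h.endo ^ (j + L)) z) := fun j z => h.commute_transport μ j z
  have hyc' : ∀ j z, Commute (y j) ((h.endo ^ (m + L)) z) := by
    intro j z
    refine hyc j _ (hWc m z) ?_
    have := (hWc m (star z)).star_star
    rwa [← map_star, star_star] at this
  -- `λ^i(y_j)` with `i ≤ m` commutes with the range of `λ^{i+m+L}`; pushing the tower by `λ^M`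
  -- makes it commute with every unitary used below.
  set M := 2 * m + L
  set E : ℕ → B := fun j => (h.endo ^ M) (e j)
  have hE : ∀ j, IsStarProjection (E j) := fun j => (he j).map (h.endo ^ M)
  have hEsum : ∑ j ∈ Finset.range m, E j = 1 := by
    simp only [E]; rw [← map_sum, hes, map_one]
  have hEm : E m = E 0 := by simp only [E, hem]
  have hEo : ∀ i < m, ∀ j < m, i ≠ j → E i * E j = 0 := fun i hi j hj hij => by
    simp only [E]; rw [← map_mul, heo i hi j hj hij, map_zero]
  have hEsh : ∀ j < m, ‖h.endo (E j) - E (j + 1)‖ ≤ ε / (2 * m) := by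
    intro j hj
    have e1 : h.endo (E j) - E (j + 1) = (h.endo ^ M) (h.endo (e j) - e (j + 1)) := by
      simp only [E]
      rw [map_sub, ← endo_pow_succ_apply, endo_pow_succ_apply']
    rw [e1]
    exact (NonUnitalStarAlgHom.norm_apply_le _ _).trans (hesh j hj).le
  set Y : ℕ → ℕ → B := fun i j => (h.endo ^ i) (y j)
  have hYc : ∀ i ≤ m, ∀ j z, Commute (Y i j) ((h.endo ^ M) z) := fun i hi j z =>
    h.commute_of_le (h.commute_endo_pow (hyc' j) i) (by omega) z
  have hWcM : ∀ j ≤ m, ∀ z, Commute (W j) ((h.endo ^ M) z) := fun j hj z =>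
    h.commute_of_le (hWc j) (by omega) z
  have hYu : ∀ i j, Y i j ∈ unitary B := fun i j => by
    have := hyu j
    rw [Unitary.mem_iff] at this ⊢
    simp only [Y]
    rw [← map_star, ← map_mul, ← map_mul, this.1, this.2, map_one]
    exact ⟨rfl, rfl⟩
  -- The path runs from `y_0 = W_m` to `y_m = 1`, so both `a_0` and `a_m` equal `W_m`: the sequence
  -- closes up around the tower. Moreover `λ(a_j) W_1` differs from `a_{j+1}` only by one step of
  -- the path.
  set a : ℕ → B := fun j => Y j j * W j
  have hac : ∀ j ≤ m, ∀ z, Commute (a j) ((h.endo ^ M) z) := fun j hj z =>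
    (hYc j hj j z).mul_left (hWcM j hj z)
  have hau : ∀ j, a j ∈ unitary B := fun j => mul_mem (hYu j j) (hWu j)
  have ha0 : a 0 = W m := by
    simp only [a, Y]
    rw [show W 0 = 1 from h.transport_zero ht, mul_one, ← hy0]
    rfl
  have ham : a m = W m := by
    simp only [a, Y]
    rw [hym, map_one, one_mul]
  set b : ℕ → B := fun j => Y (j + 1) j * W (j + 1)
  have hb : ∀ j, h.endo (a j) * W 1 = b j := by
    intro j
    simp only [a, b, Y, W]
    rw [map_mul, mul_assoc, h.endo_transport_mul ht, ← endo_pow_succ_apply]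
  have hbc : ∀ j < m, ∀ z, Commute (b j) ((h.endo ^ M) z) := fun j hj z =>
    (hYc (j + 1) hj j z).mul_left (hWcM (j + 1) hj z)
  have hbn : ∀ j, ‖b j‖ ≤ 1 := fun j =>
    (CStarRing.norm_of_mem_unitary (mul_mem (hYu _ _) (hWu _))).le
  have hba : ∀ j, ‖b j - a (j + 1)‖ ≤ Real.pi / m := by
    intro j
    have e1 : b j - a (j + 1) = (h.endo ^ (j + 1)) (y j - y (j + 1)) * W (j + 1) := by
      simp only [a, b, Y]; rw [map_sub, sub_mul]
    rw [e1]
    exact (norm_mul_le_of_right (CStarRing.norm_of_mem_unitary (hWu _)).le).trans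
      ((NonUnitalStarAlgHom.norm_apply_le _ _).trans (hystep j))
  set v : B := ∑ j ∈ Finset.range m, a j * E j
  have hstarE : ∀ j, star (E j) = E j := fun j => (hE j).isSelfAdjoint.star_eq
  have haE : ∀ j ≤ m, ∀ i, a j * E i = E i * a j := fun j hj i => (hac j hj _).eq
  have hasE : ∀ j ≤ m, ∀ i, star (a j) * E i = E i * star (a j) := fun j hj i => by
    have := (show Commute (a j) (E i) from hac j hj _).star_star
    rw [hstarE] at this
    exact this.eq
  have hEE : ∀ i ∈ Finset.range m, ∀ j ∈ Finset.range m, E i * E j = if i = j then E i else 0 := by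
    intro i hi j hj
    split_ifs with hij
    · subst hij; exact (hE i).isIdempotentElem
    · exact hEo i (Finset.mem_range.mp hi) j (Finset.mem_range.mp hj) hij
  have hv : v ∈ unitary B := by
    have hsv : star v = ∑ j ∈ Finset.range m, E j * star (a j) := by
      simp only [v, star_sum, star_mul, hstarE]
    rw [Unitary.mem_iff, hsv]
    constructor
    · rw [Finset.sum_mul_sum, ← hEsum]
      refine Finset.sum_congr rfl fun i hi => ?_
      have hi' := (Finset.mem_range.mp hi).le
      rw [Finset.sum_eq_single_of_mem i hi]
      · rw [haE i hi', mul_assoc, ← mul_assoc (star (a i)), hasE i hi', mul_assoc (E i),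
          Unitary.star_mul_self_of_mem (hau i), mul_one, (hE i).isIdempotentElem.eq]
      · intro j hj hij
        rw [← hasE i hi', haE j (Finset.mem_range.mp hj).le, mul_assoc, ← mul_assoc (E i),
          hEE i hi j hj, if_neg (Ne.symm hij), zero_mul, mul_zero]
    · rw [Finset.sum_mul_sum, ← hEsum]
      refine Finset.sum_congr rfl fun i hi => ?_
      have hi' := (Finset.mem_range.mp hi).le
      rw [Finset.sum_eq_single_of_mem i hi]
      · rw [mul_assoc, ← mul_assoc (E i), (hE i).isIdempotentElem.eq, ← mul_assoc, haE i hi',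
          mul_assoc, Unitary.mul_star_self_of_mem (hau i), mul_one]
      · intro j hj hij
        rw [mul_assoc, ← mul_assoc (E i), hEE i hi j hj, if_neg (Ne.symm hij), zero_mul, mul_zero]
  refine ⟨v, hv, ?_⟩
  have hvshift : ∀ x : ℕ → B, x 0 = x m →
      ∑ j ∈ Finset.range m, x j = ∑ j ∈ Finset.range m, x (j + 1) := by
    intro x hx
    have h1 := Finset.sum_range_succ x m
    have h2 := Finset.sum_range_succ' x m
    rw [h1, hx] at h2
    exact add_right_cancel h2
  have hv' : v = ∑ j ∈ Finset.range m, a (j + 1) * E (j + 1) :=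
    hvshift (fun j => a j * E j) (by simp only [ha0, ham, hEm])
  have hEW : ∀ j, h.endo (E j) * W 1 = W 1 * h.endo (E j) := by
    intro j
    have := hWcM 1 hm (h.endo (e j))
    simp only [E]
    rw [← endo_pow_succ_apply, endo_pow_succ_apply']
    exact this.eq.symm
  -- Tower errors add up over `m` levels of size `ε/(2m)`. Path errors are compressed by orthogonal
  -- projections, so they count only through their maximum.
  have e1 : h.endo v * W 1 - v = ∑ j ∈ Finset.range m, b j * (h.endo (E j) - E (j + 1)) +
      ∑ j ∈ Finset.range m, star (E (j + 1)) * (b j - a (j + 1)) * E (j + 1) := by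
    conv_lhs => rw [hv']
    have : h.endo (∑ j ∈ Finset.range m, a (j + 1) * E (j + 1)) = h.endo v := by rw [← hv']
    rw [this]
    simp only [v]
    rw [map_sum, Finset.sum_mul, ← Finset.sum_sub_distrib, ← Finset.sum_add_distrib]
    refine Finset.sum_congr rfl fun j hj => ?_
    have hj' := Finset.mem_range.mp hj
    have hc : E (j + 1) * (b j - a (j + 1)) = (b j - a (j + 1)) * E (j + 1) := by
      rw [mul_sub, sub_mul, haE (j + 1) hj', (hbc j hj' _).eq]
    rw [map_mul, mul_assoc, hEW, ← mul_assoc, hb, hstarE, hc, mul_assoc (b j - a (j + 1)),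
      (hE _).isIdempotentElem.eq]
    simp only [mul_sub, sub_mul]
    abel
  rw [e1]
  refine (norm_add_le _ _).trans ?_
  have g1 : ‖∑ j ∈ Finset.range m, b j * (h.endo (E j) - E (j + 1))‖ ≤ ε / 2 := by
    refine (norm_sum_le_of_le (n := fun _ => ε / (2 * m)) _ fun j hj => ?_).trans (le_of_eq ?_)
    · exact (norm_mul_le_of_left (hbn j)).trans (hEsh j (Finset.mem_range.mp hj))
    · simp only [Finset.sum_const, Finset.card_range, nsmul_eq_mul]
      field_simp
  have g2 : ‖∑ j ∈ Finset.range m, star (E (j + 1)) * (b j - a (j + 1)) * E (j + 1)‖ ≤ ε / 2 := by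
    rw [Finset.sum_range]
    refine (norm_sum_conj_le_of_sum_eq_one (fun j : Fin m => E (j + 1))
      (fun j : Fin m => b j - a (j + 1)) ?_ (fun j => hba j) (by positivity)).trans hπ
    simp only [hstarE, (hE _).isIdempotentElem.eq]
    rw [← Finset.sum_range (fun j => E (j + 1)), ← hvshift E hEm.symm, hEsum]
  linarith

/-- The algebra generated by two Cuntz isometries contains unital matrix algebras which almost
commute with the generators. -/
theorem exists_central_matrixHom (h : IsCuntzFamily s) (n : ℕ) [NeZero n] {ε : ℝ} (hε : 0 < ε) :
    ∃ φ : Matrix (Fin n) (Fin n) ℂ →⋆ₐ[ℂ] B, ∀ i j k,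
      ‖φ (Matrix.single i j 1) * s k - s k * φ (Matrix.single i j 1)‖ < ε := by
  obtain ⟨n, rfl⟩ := Nat.exists_eq_succ_of_ne_zero (NeZero.ne n)
  obtain ⟨μ, ht⟩ := h.exists_words n
  obtain ⟨v, hv, hvW⟩ := h.exists_unitary_endo_mul_transport μ ht (ε := ε / 4) (by positivity)
  set t : Fin (n + 1) → B := fun k => word s (μ k)
  set W := h.transport t 1
  refine ⟨((Unitary.conjStarAlgAut ℂ B ⟨v, hv⟩ : B ≃⋆ₐ[ℂ] B) : B →⋆ₐ[ℂ] B).comp ht.matrixHom,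
    fun i j k => ?_⟩
  have e0 : (((Unitary.conjStarAlgAut ℂ B ⟨v, hv⟩ : B ≃⋆ₐ[ℂ] B) : B →⋆ₐ[ℂ] B).comp ht.matrixHom)
      (Matrix.single i j 1) = v * (t i * star (t j)) * star v := by
    rw [StarAlgHom.comp_apply, ht.matrixHom_single]
    exact Unitary.conjStarAlgAut_apply (S := ℂ) ⟨v, hv⟩ _
  set p : B := t i * star (t j)
  have hp : ‖p‖ ≤ 1 := by
    have := norm_map_single_le ht.matrixHom i j
    rwa [ht.matrixHom_single] at this
  rw [e0]
  set F : B := v * p * star v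
  -- `λ` acts on the matrix units of `t` as conjugation by `W`, so `λ(v) W ≈ v` makes `F` almost
  -- fixed by `λ`.
  have e1 : h.endo F = (h.endo v * W) * p * star (h.endo v * W) := by
    have h1 : h.endo p = W * p * star W := by
      have h2 : ∀ i, h.endo (t i) = W * t i := fun i => by
        have := h.transport_mul ht 1 i
        rw [pow_one] at this
        exact this.symm
      simp only [p]
      rw [map_mul, map_star, h2, h2, star_mul]
      simp only [mul_assoc]
    simp only [F]
    rw [map_mul, map_mul, h1, star_mul, map_star]
    simp only [mul_assoc]
  have e2 : h.endo F - F = (h.endo v * W - v) * p * star (h.endo v * W) +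
      v * p * star (h.endo v * W - v) := by
    rw [e1, star_sub]
    simp only [F, mul_sub, sub_mul]
    abel
  have hvn : ‖v‖ ≤ 1 := (CStarRing.norm_of_mem_unitary hv).le
  have hWn : ‖h.endo v * W‖ ≤ 1 := by
    refine (norm_mul_le_of_right
      (CStarRing.norm_of_mem_unitary (h.transport_mem_unitary ht 1)).le).trans ?_
    exact (NonUnitalStarAlgHom.norm_apply_le h.endo v).trans hvn
  have h3 : ‖h.endo F - F‖ ≤ ε / 2 := by
    rw [e2]
    refine (norm_add_le _ _).trans ?_
    have g1 : ‖(h.endo v * W - v) * p * star (h.endo v * W)‖ ≤ ε / 4 :=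
      (norm_mul_le_of_right (by rwa [norm_star])).trans ((norm_mul_le_of_right hp).trans hvW)
    have g2 : ‖v * p * star (h.endo v * W - v)‖ ≤ ε / 4 := by
      rw [mul_assoc]
      refine (norm_mul_le_of_left hvn).trans ((norm_mul_le_of_left hp).trans ?_)
      rwa [norm_star]
    linarith
  have e3 : F * s k - s k * F = -((h.endo F - F) * s k) := by
    rw [sub_mul, h.endo_mul, neg_sub]
  have hs : ‖s k‖ ≤ 1 := by
    have h1 := CStarRing.norm_star_mul_self (x := s k)
    rw [h.star_mul_eq, if_pos rfl, norm_one] at h1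
    nlinarith [norm_nonneg (s k)]
  rw [e3, norm_neg]
  refine ((norm_mul_le_of_right hs).trans h3).trans_lt ?_
  linarith

end IsCuntzFamily

end Coboundary

/-! ### The concrete algebra `𝒪₂` -/

section CuntzTwo

theorem blockIsometry_two_mem_cuntzTwo (i : Fin 2) : blockIsometry 2 i ∈ cuntzTwo := by
  refine StarSubalgebra.le_topologicalClosure _ (StarAlgebra.subset_adjoin ℂ _ ?_)
  fin_cases i
  · exact Or.inl rfl
  · exact Or.inr rfl

/-- The canonical generators of `𝒪₂`. -/
noncomputable def cuntzTwoGen (i : Fin 2) : cuntzTwo :=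
  ⟨blockIsometry 2 i, blockIsometry_two_mem_cuntzTwo i⟩

theorem isCuntzFamily_cuntzTwoGen : IsCuntzFamily cuntzTwoGen where
  star_mul_eq i j := by
    apply Subtype.ext
    have h := star_blockIsometry_mul 2 i j
    split_ifs at h ⊢ <;> exact h
  sum_mul_star := by
    apply Subtype.ext
    have h := (isCuntzFamily_blockIsometry 2).sum_mul_star
    rw [Fin.sum_univ_two] at h ⊢
    exact h

instance : Nontrivial cuntzTwo := by
  refine ⟨0, 1, fun h => ?_⟩
  have h1 : (0 : EllTwo →L[ℂ] EllTwo) = 1 := congrArg Subtype.val h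
  have h2 := stdBasis.orthonormal.1 0
  have h3 : (0 : EllTwo) = stdBasis 0 := congrArg (fun T : EllTwo →L[ℂ] EllTwo => T (stdBasis 0)) h1
  rw [← h3, norm_zero] at h2
  exact zero_ne_one h2

theorem hasCentralMatrixUnits_cuntzTwo (n : ℕ) [NeZero n] : HasCentralMatrixUnits n cuntzTwo := by
  refine hasCentralMatrixUnits_of_dense _ (dense_adjoin_preimage_val _ _ rfl) ?_
  intro F ε hF hε
  obtain ⟨φ, hφ⟩ := isCuntzFamily_cuntzTwoGen.exists_central_matrixHom n hε
  refine ⟨φ, fun i j a ha => ?_⟩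
  rcases hF ha with h | h
  · have : a = cuntzTwoGen 0 := Subtype.ext h
    rw [this]
    exact hφ i j 0
  · have : a = cuntzTwoGen 1 := Subtype.ext h
    rw [this]
    exact hφ i j 1

end CuntzTwo

/-- Both halves use only central matrix units. The second is proved directly inside `𝒪₂`, without
passing through absorption of `𝒬` by `𝒪₂`. -/
theorem mainTheorem4 {A : Type*} [CStarAlgebra A] [Nontrivial A]
    [TopologicalSpace.SeparableSpace A]
    (α : Circle →* (A ≃⋆ₐ[ℂ] A)) (hcont : ∀ a : A, Continuous fun ζ : Circle => α ζ a)
    (hα : CircleRokhlinProperty α) :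
    (TensoriallyAbsorbs A universalUHF →
      ∀ (n : ℕ) [NeZero n], FiniteRokhlinProperty (restrictCyclic α n)) ∧
    (TensoriallyAbsorbs A cuntzTwo →
      ∀ (n : ℕ) [NeZero n], FiniteRokhlinProperty (restrictCyclic α n)) :=
  ⟨fun h n _ => finiteRokhlinProperty_of_hasCentralMatrixUnits α hcont hα n
    (hasCentralMatrixUnits_of_tensoriallyAbsorbs (hasCentralMatrixUnits_universalUHF n) h),
  fun h n _ => finiteRokhlinProperty_of_hasCentralMatrixUnits α hcont hα n
    (hasCentralMatrixUnits_of_tensoriallyAbsorbs (hasCentralMatrixUnits_cuntzTwo n) h)⟩
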